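/- Let $p,q\ge 1$ and let $\mathbf X$ and $\mathbf Y=(Y_1,\dots,Y_q)$ be random vectors on a common probability space with values in $\mathbb R^p$ and $\mathbb R^q$. Suppose that $(\mathbf X,\mathbf Y)\sim\mathcal E(\boldsymbol\mu,\Sigma,\phi)$ is elliptically distributed, i.e. $\boldsymbol\mu\in\mathbb R^{p+q}$, $\Sigma=\begin{pmatrix}\Sigma_{11}&\Sigma_{12}\\ \Sigma_{21}&\Sigma_{22}\end{pmatrix}\in\mathbb R^{(p+q)\times(p+q)}$ (with $\Sigma_{11}\in\mathbb R^{p\times p}$) is symmetric positive semi-definite, $\phi:[0,\infty)\to\mathbb R$, and the characteristic function of $(\mathbf X,\mathbf Y)-\boldsymbol\mu$ is $\mathbf t\mapsto\phi(\mathbf t^{T}\Sigma\,\mathbf t)$, $\mathbf t\in\mathbb R^{p+q}$. Suppose that no component of $\mathbf X$ or of $\mathbf Y$ is almost surely constant. For a non-degenerate real random variable $V$ and a random vector $\mathbf W$ let \[ \xi(V,\mathbf W)=\frac{\int_{\mathbb R}\mathrm{Var}\big(P(V\ge y\mid\mathbf W)\big)\,\mathrm dP^{V}(y)}{\int_{\mathbb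 R}\mathrm{Var}\big(\mathbf 1_{\{V\ge y\}}\big)\,\mathrm dP^{V}(y)} \] be Chatterjee's rank correlation, and let \[ T(\mathbf Y,\mathbf X)=1-\frac{q-\sum_{i=1}^{q}\xi\big(Y_i,(\mathbf X,Y_{i-1},\dots,Y_1)\big)}{q-\sum_{i=1}^{q}\xi\big(Y_i,(Y_{i-1},\dots,Y_1)\big)},\qquad \xi(Y_1,\emptyset):=0 . \] Then: (i) $T(\mathbf Y,\mathbf X)=0$ if and only if $\Sigma_{12}=0$ and $(\mathbf X,\mathbf Y)$ is multivariate normally distributed (possibly with singular covariance matrix); (ii) $T(\mathbf Y,\mathbf X)=1$ if and only if $\operatorname{rank}(\Sigma)=\operatorname{rank}(\Sigma_{11})$. -/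

import Mathlib

open MeasureTheory ProbabilityTheory
open scoped NNReal Matrix

noncomputable section

namespace RankDep

variable {Ω : Type*} [MeasurableSpace Ω]

/-- A real random variable is non-degenerate if it is not almost surely equal to a constant. -/
def NonDegenerate (V : Ω → ℝ) (P : Measure Ω) : Prop :=
  ¬ ∃ c : ℝ, ∀ᵐ ω ∂P, V ω = c

/-- Chatterjee's rank correlation
`ξ(V, W) = ∫ Var(P(V ≥ y | W)) dP^V(y) / ∫ Var(1_{V ≥ y}) dP^V(y)`
of a real random variable `V` given a random vector `W`. Conditioning on `W` is conditioning on
the σ-algebra generated by `W`. -/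
def xi {E : Type*} [mE : MeasurableSpace E] (V : Ω → ℝ) (W : Ω → E) (P : Measure Ω) : ℝ :=
  (∫ y, Var[P⟦{ω | y ≤ V ω} | mE.comap W⟧; P] ∂(P.map V)) /
    (∫ y, Var[{ω | y ≤ V ω}.indicator (fun _ => (1 : ℝ)); P] ∂(P.map V))

/-- Conditioning on the vector without components gives the value `0`, so that the convention
`ξ(Y₁, ∅) = 0` is built into the definition. -/
theorem xi_of_subsingleton {E : Type*} [mE : MeasurableSpace E] [Subsingleton E] (V : Ω → ℝ)
    (W : Ω → E) (P : Measure Ω) [IsProbabilityMeasure P] : xi V W P = 0 := by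
  have h : mE.comap W = ⊥ := by
    refine le_antisymm ?_ bot_le
    rintro s ⟨t, -, rfl⟩
    rcases t.eq_empty_or_nonempty with rfl | ⟨x, hx⟩
    · simp
    · have : W ⁻¹' t = Set.univ := by
        ext ω
        simp [Subsingleton.elim (W ω) x, hx]
      rw [this]
      exact @MeasurableSet.univ _ ⊥
  have hc : ∀ c : ℝ, Var[fun _ : Ω => c; P] = 0 := fun c => by simp [variance, evariance]
  simp [xi, h, condExp_bot, hc]

/-- The vector `(Y_j)_{j < i}` of the components of `Y` before the `i`-th one. -/
def preceding {q : ℕ} (Y : Ω → EuclideanSpace ℝ (Fin q)) (i : Fin q) :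
    Ω → ({j : Fin q // j < i} → ℝ) :=
  fun ω j => Y ω j

/-- The multi-response extension of Chatterjee's rank correlation,
`T(Y, X) = 1 - (q - ∑ᵢ ξ(Yᵢ, (X, Yᵢ₋₁, …, Y₁))) / (q - ∑ᵢ ξ(Yᵢ, (Yᵢ₋₁, …, Y₁)))`. -/
def T {p q : ℕ} (Y : Ω → EuclideanSpace ℝ (Fin q)) (X : Ω → EuclideanSpace ℝ (Fin p))
    (P : Measure Ω) : ℝ :=
  1 - ((q : ℝ) - ∑ i : Fin q, xi (fun ω => Y ω i) (fun ω => (X ω, preceding Y i ω)) P) /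
      ((q : ℝ) - ∑ i : Fin q, xi (fun ω => Y ω i) (preceding Y i) P)

/-- The random vector `(X, Y)` with values in `ℝ^(p+q)`. -/
def joint {p q : ℕ} (X : Ω → EuclideanSpace ℝ (Fin p)) (Y : Ω → EuclideanSpace ℝ (Fin q)) :
    Ω → EuclideanSpace ℝ (Fin p ⊕ Fin q) :=
  fun ω => WithLp.toLp 2 (Sum.elim (X ω) (Y ω))

/-- `Z ∼ ℰ(m, S, φ)`: the scale matrix `S` is positive semi-definite and the characteristic
function of `Z - m` is `t ↦ φ(tᵀ S t)`. -/
def IsElliptical {ι : Type*} [Fintype ι] (Z : Ω → EuclideanSpace ℝ ι) (P : Measure Ω)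
    (m : EuclideanSpace ℝ ι) (S : Matrix ι ι ℝ) (φ : ℝ≥0 → ℝ) : Prop :=
  S.PosSemidef ∧
    ∀ t : EuclideanSpace ℝ ι,
      charFun (P.map (fun ω => Z ω - m)) t = (φ (t.ofLp ⬝ᵥ (S *ᵥ t.ofLp)).toNNReal : ℂ)

end RankDep

end

/-! Up to normalisation, `xi V W P` is the averaged variance of the conditional tails of `V`. By the
tower property, enlarging the conditioning σ-algebra raises this variance by a squared L² distance.
Hence `xi` is unchanged by adding `X` exactly when the conditional tails are unchanged, and equals
one exactly when `V` is almost surely a function of `W`. The levels `y` are controlled only up to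
null sets of the law of `V`; `exists_seq_Ici_of_ae` shows that this is enough. Induction over the
coordinates of `Y` then gives `T_eq_zero_iff_indepFun` and `T_eq_one_iff_exists_measurable`, valid
for all vectors with non-degenerate `Y` coordinates.

For (i), independence makes the generator `φ` multiplicative on pairs of coordinates. Flipping one
sign forces the mixed coefficient to vanish (`mixed_coeff_eq_zero`). What remains is `φ (x + y) = φ
x * φ y`, so `φ` is an exponential and the law is Gaussian. Conversely, for a Gaussian vector a
vanishing block gives zero covariances and hence independence.

For (ii), choose `A` with `Σ₂₁ = A Σ₁₁`. The reflection `(x, y) ↦ (x, 2Ax - y)` preserves `Σ`, hence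
the law of the centred vector. If `Y = f(X)`, the reflected vector satisfies the same relation with
the same `X`, so `Y` coincides with its reflection and is affine in `X` with slope `A`; no moments
are needed. Then the residual direction has zero quadratic form, which means `Σ₂₂ = A Σ₁₂`, the rank
condition by `rank_eq_rank_toBlocks₁₁_iff`. Conversely, that identity makes the residual vanish
almost surely. -/

namespace RankDep

/-! ### Conditional tail probabilities and the extreme values of `xi`. -/

section Tail

variable {Ω : Type*} {m m₁ m₂ mΩ : MeasurableSpace Ω}

/-- If a property of real numbers holds `ν`-almost everywhere, then every upper ray is, up to a
`ν`-null set, a countable union of upper rays starting at points with this property. -/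
theorem exists_seq_Ici_of_ae (ν : Measure ℝ) {D : ℝ → Prop} (hD : ∀ᵐ y ∂ν, D y) (y : ℝ) :
    ν (Set.Ici y) = 0 ∨ ∃ u : ℕ → ℝ, Antitone u ∧ (∀ n, D (u n) ∧ y ≤ u n) ∧
      ν (Set.Ici y \ ⋃ n, Set.Ici (u n)) = 0 := by
  set A : Set ℝ := {s | D s ∧ y ≤ s} with hA
  have hbad : ν {s | ¬ D s} = 0 := hD
  rcases A.eq_empty_or_nonempty with hE | hne
  · left
    refine measure_mono_null (fun s hs => ?_) hbad
    intro h
    exact (Set.mem_empty_iff_false s).1 (hE ▸ (⟨h, hs⟩ : s ∈ A))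
  · right
    have hbdd : BddBelow A := ⟨y, fun s hs => hs.2⟩
    -- If the infimum of the good points is attained, a constant sequence works. Otherwise every
    -- good point lies strictly above it and is passed by a decreasing sequence.
    by_cases hmem : sInf A ∈ A
    · refine ⟨fun _ => sInf A, fun _ _ _ => le_rfl, fun _ => hmem, ?_⟩
      refine measure_mono_null (fun s hs => ?_) hbad
      intro h
      exact hs.2 (Set.mem_iUnion.2 ⟨0, csInf_le hbdd ⟨h, hs.1⟩⟩)
    · obtain ⟨u, hu, hlim, huA⟩ := exists_seq_tendsto_sInf hne hbdd
      refine ⟨u, hu, huA, ?_⟩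
      refine measure_mono_null (fun s hs => ?_) hbad
      intro h
      have hsA : s ∈ A := ⟨h, hs.1⟩
      have hlt : sInf A < s := lt_of_le_of_ne (csInf_le hbdd hsA) (fun e => hmem (e ▸ hsA))
      obtain ⟨n, hn⟩ := (hlim.eventually (gt_mem_nhds hlt)).exists
      exact hs.2 (Set.mem_iUnion.2 ⟨n, hn.le⟩)

/-- Two finite measures that are absolutely continuous with respect to `ν` are equal as soon as
they agree on the upper rays starting at `ν`-almost every point. -/
theorem ext_of_ae_Ici {ν μ₁ μ₂ : Measure ℝ} [IsFiniteMeasure μ₁] (h₁ : μ₁ ≪ ν) (h₂ : μ₂ ≪ ν)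
    (h : ∀ᵐ y ∂ν, μ₁ (Set.Ici y) = μ₂ (Set.Ici y)) : μ₁ = μ₂ := by
  refine Measure.ext_of_Ici _ _ fun y => ?_
  rcases exists_seq_Ici_of_ae ν h y with h0 | ⟨u, hu, hD, hnull⟩
  · rw [h₁ h0, h₂ h0]
  · have hsub : (⋃ n, Set.Ici (u n)) ⊆ Set.Ici y :=
      Set.iUnion_subset fun n => Set.Ici_subset_Ici.2 (hD n).2
    have key : ∀ μ : Measure ℝ, μ ≪ ν → μ (Set.Ici y) = ⨆ n, μ (Set.Ici (u n)) := by
      intro μ hμ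
      have hmono : Monotone fun n => Set.Ici (u n) :=
        fun a b hab => Set.Ici_subset_Ici.2 (hu hab)
      rw [← hmono.measure_iUnion]
      refine (measure_mono hsub).antisymm' ?_
      exact measure_mono_ae (ae_le_set.2 (hμ hnull))
    rw [key μ₁ h₁, key μ₂ h₂]
    exact iSup_congr fun n => (hD n).1

theorem measurableSet_tail {V : Ω → ℝ} (hV : Measurable V) (y : ℝ) :
    MeasurableSet {ω | y ≤ V ω} := hV measurableSet_Ici

theorem memLp_tail (P : Measure Ω) [IsFiniteMeasure P] {V : Ω → ℝ} (hV : Measurable V) (y : ℝ)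
    (r : ENNReal) : MemLp ({ω | y ≤ V ω}.indicator fun _ => (1 : ℝ)) r P :=
  (memLp_const (1 : ℝ)).indicator (measurableSet_tail hV y)

theorem integrable_tail (P : Measure Ω) [IsFiniteMeasure P] {V : Ω → ℝ} (hV : Measurable V)
    (y : ℝ) : Integrable ({ω | y ≤ V ω}.indicator fun _ => (1 : ℝ)) P :=
  (integrable_const (1 : ℝ)).indicator (measurableSet_tail hV y)

/-- Enlarging the conditioning σ-algebra increases the variance of a conditional expectation by
the squared `L²`-distance of the two conditional expectations. -/
theorem variance_condExp_sub {P : Measure Ω} [IsProbabilityMeasure P]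
    (h₁₂ : m₁ ≤ m₂) (h₂ : m₂ ≤ mΩ) {f : Ω → ℝ} (hf : MemLp f 2 P) :
    Var[P[f|m₂]; P] = Var[P[f|m₁]; P] + ∫ ω, ((P[f|m₂]) ω - (P[f|m₁]) ω) ^ 2 ∂P := by
  have hX : MemLp (P[f|m₂]) 2 P := hf.condExp one_le_two
  have htower : P[P[f|m₂]|m₁] =ᵐ[P] P[f|m₁] := condExp_condExp_of_le h₁₂ h₂
  -- Law of total variance for `P[f|m₂]` conditioned on `m₁`; the integrated conditional variance is
  -- the squared distance.
  rw [← integral_condVar_add_variance_condExp (h₁₂.trans h₂) hX, variance_congr htower, add_comm]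
  congr 1
  rw [condVar, integral_condExp (h₁₂.trans h₂)]
  refine integral_congr_ae ?_
  filter_upwards [htower] with ω hω
  simp [hω]

theorem variance_condExp_mono {P : Measure Ω} [IsProbabilityMeasure P]
    (h₁₂ : m₁ ≤ m₂) (h₂ : m₂ ≤ mΩ) {f : Ω → ℝ} (hf : MemLp f 2 P) :
    Var[P[f|m₁]; P] ≤ Var[P[f|m₂]; P] := by
  rw [variance_condExp_sub h₁₂ h₂ hf]
  exact le_add_of_nonneg_right (integral_nonneg fun _ => sq_nonneg _)

theorem variance_condExp_eq_iff {P : Measure Ω} [IsProbabilityMeasure P]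
    (h₁₂ : m₁ ≤ m₂) (h₂ : m₂ ≤ mΩ) {f : Ω → ℝ} (hf : MemLp f 2 P) :
    Var[P[f|m₁]; P] = Var[P[f|m₂]; P] ↔ P[f|m₂] =ᵐ[P] P[f|m₁] := by
  have hint : Integrable (fun ω => ((P[f|m₂]) ω - (P[f|m₁]) ω) ^ 2) P :=
    ((hf.condExp one_le_two).sub (hf.condExp one_le_two)).integrable_sq
  rw [variance_condExp_sub h₁₂ h₂ hf, left_eq_add,
    integral_eq_zero_iff_of_nonneg (fun _ => sq_nonneg _) hint]
  refine ⟨fun h => ?_, fun h => ?_⟩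
  · filter_upwards [h] with ω hω
    have : (P[f|m₂]) ω - (P[f|m₁]) ω = 0 := by simpa using hω
    linarith
  · filter_upwards [h] with ω hω
    simp [hω]

/-- The variance of the conditional tail probability `P(V ≥ y | m)` as a function of `y`. -/
noncomputable def tailVar (m : MeasurableSpace Ω) {mΩ : MeasurableSpace Ω} (V : Ω → ℝ) (P : Measure Ω)
    (y : ℝ) : ℝ :=
  Var[P⟦{ω | y ≤ V ω} | m⟧; P]

/-- The part of the variance of the tail indicators of `V` that is explained by `m`. -/
noncomputable def explainedVar (m : MeasurableSpace Ω) {mΩ : MeasurableSpace Ω} (V : Ω → ℝ)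
    (P : Measure Ω) : ℝ :=
  ∫ y, tailVar m V P y ∂(P.map V)

variable {P : Measure Ω} {V : Ω → ℝ}

theorem condExp_tail_nonneg (y : ℝ) :
    0 ≤ᵐ[P] P⟦{ω | y ≤ V ω} | m⟧ :=
  condExp_nonneg (Filter.Eventually.of_forall fun ω => Set.indicator_nonneg (by simp) ω)

theorem tailVar_nonneg (y : ℝ) : 0 ≤ tailVar m V P y :=
  variance_nonneg _ _

/-- A real function whose upper level sets all agree almost everywhere with `m`-measurable sets
agrees almost everywhere with an `m`-measurable function. -/
theorem exists_measurable_ae_eq_of_tail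
    (h : ∀ y : ℝ, ∃ A : Set Ω, MeasurableSet[m] A ∧ {ω | y ≤ V ω} =ᵐ[P] A) :
    ∃ g : Ω → ℝ, Measurable[m] g ∧ V =ᵐ[P] g := by
  classical
  choose A hA hVA using h
  -- `V` is recovered as the supremum of the rationals below it. Values in `EReal` make this
  -- supremum exist even on the exceptional null set.
  let G : Ω → EReal := fun ω => ⨆ r : ℚ, if ω ∈ A (r : ℝ) then ((r : ℝ) : EReal) else ⊥
  have hG : Measurable[m] G :=
    Measurable.iSup fun r => Measurable.ite (hA r) measurable_const measurable_const
  refine ⟨fun ω => (G ω).toReal, measurable_ereal_toReal.comp hG, ?_⟩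
  have hall : ∀ᵐ ω ∂P, ∀ r : ℚ, ((r : ℝ) ≤ V ω ↔ ω ∈ A (r : ℝ)) :=
    ae_all_iff.2 fun r => (hVA r).mem_iff
  filter_upwards [hall] with ω hω
  have : G ω = (V ω : EReal) := by
    refine le_antisymm (iSup_le fun r => ?_) (le_of_forall_lt fun c hc => ?_)
    · by_cases hr : ω ∈ A (r : ℝ)
      · simpa [hr] using (hω r).2 hr
      · simp [hr]
    · obtain ⟨r, hcr, hrV⟩ := EReal.lt_iff_exists_rat_btwn.1 hc
      have hr : ω ∈ A (r : ℝ) := (hω r).1 (by exact_mod_cast hrV.le)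
      refine hcr.trans_le (le_trans ?_ (le_iSup _ r))
      simp [hr]
  simp [this]

variable [IsProbabilityMeasure P]

theorem condExp_tail_antitone (hV : Measurable V) {y z : ℝ} (h : y ≤ z) :
    P⟦{ω | z ≤ V ω} | m⟧ ≤ᵐ[P] P⟦{ω | y ≤ V ω} | m⟧ := by
  refine condExp_mono (integrable_tail P hV z) (integrable_tail P hV y)
    (Filter.Eventually.of_forall fun ω => ?_)
  exact Set.indicator_le_indicator_of_subset (fun ω (hω : z ≤ V ω) => h.trans hω)
    (fun _ => zero_le_one) ω

/-- The first two moments of the conditional tail are antitone in the level, so no joint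
measurability in level and sample point is required. -/
theorem measurable_tailVar (hV : Measurable V) :
    Measurable (tailVar m V P) := by
  have hL : ∀ y, MemLp (P⟦{ω | y ≤ V ω} | m⟧) 2 P := fun y =>
    (memLp_tail P hV y 2).condExp one_le_two
  have h : tailVar m V P = fun y => (∫ ω, ((P⟦{ω | y ≤ V ω} | m⟧) ω) ^ 2 ∂P) -
      (∫ ω, (P⟦{ω | y ≤ V ω} | m⟧) ω ∂P) ^ 2 := by
    ext y
    exact variance_eq_sub (hL y)
  rw [h]
  refine Measurable.sub (Antitone.measurable fun y z hyz => ?_)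
    ((Antitone.measurable fun y z hyz => ?_).pow_const 2)
  · refine integral_mono_ae (hL z).integrable_sq (hL y).integrable_sq ?_
    filter_upwards [condExp_tail_antitone hV hyz, condExp_tail_nonneg (P := P) (V := V) z]
      with ω h1 h2
    exact pow_le_pow_left₀ h2 h1 2
  · exact integral_mono_ae integrable_condExp integrable_condExp (condExp_tail_antitone hV hyz)

theorem tailVar_mono (hV : Measurable V) (h₁₂ : m₁ ≤ m₂)
    (h₂ : m₂ ≤ mΩ) (y : ℝ) : tailVar m₁ V P y ≤ tailVar m₂ V P y :=
  variance_condExp_mono h₁₂ h₂ (memLp_tail P hV y 2)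

theorem condExp_tail_self (hV : Measurable V) (y : ℝ) :
    P⟦{ω | y ≤ V ω} | mΩ⟧ = {ω | y ≤ V ω}.indicator fun _ => (1 : ℝ) :=
  condExp_of_stronglyMeasurable le_rfl
    (stronglyMeasurable_const.indicator (measurableSet_tail hV y)) (integrable_tail P hV y)

theorem tailVar_le_one (hV : Measurable V) (hm : m ≤ mΩ) (y : ℝ) :
    tailVar m V P y ≤ 1 := by
  refine (tailVar_mono hV hm le_rfl y).trans ?_
  rw [tailVar, condExp_tail_self hV]
  refine (variance_le_expectation_sq (integrable_tail P hV y).aestronglyMeasurable).trans ?_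
  refine (integral_mono_of_nonneg (g := fun _ => (1 : ℝ)) (.of_forall fun _ => sq_nonneg _)
    (integrable_const _) (.of_forall fun ω => ?_)).trans (by simp)
  by_cases h : y ≤ V ω <;> simp [Set.indicator, h]

theorem integrable_tailVar (hV : Measurable V) (hm : m ≤ mΩ) :
    Integrable (tailVar m V P) (P.map V) := by
  have : IsProbabilityMeasure (P.map V) := Measure.isProbabilityMeasure_map hV.aemeasurable
  refine Integrable.of_bound (C := 1) (measurable_tailVar hV).aestronglyMeasurable
    (.of_forall fun y => ?_)
  rw [Real.norm_eq_abs, abs_of_nonneg (tailVar_nonneg y)]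
  exact tailVar_le_one hV hm y

theorem explainedVar_mono (hV : Measurable V) (h₁₂ : m₁ ≤ m₂)
    (h₂ : m₂ ≤ mΩ) : explainedVar m₁ V P ≤ explainedVar m₂ V P :=
  integral_mono (integrable_tailVar hV (h₁₂.trans h₂)) (integrable_tailVar hV h₂)
    (tailVar_mono hV h₁₂ h₂)

theorem explainedVar_eq_iff (hV : Measurable V) (h₁₂ : m₁ ≤ m₂)
    (h₂ : m₂ ≤ mΩ) : explainedVar m₁ V P = explainedVar m₂ V P ↔
      ∀ᵐ y ∂(P.map V), P⟦{ω | y ≤ V ω} | m₂⟧ =ᵐ[P] P⟦{ω | y ≤ V ω} | m₁⟧ := by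
  rw [explainedVar, explainedVar, integral_eq_iff_of_ae_le (integrable_tailVar hV (h₁₂.trans h₂))
    (integrable_tailVar hV h₂) (.of_forall (tailVar_mono hV h₁₂ h₂))]
  exact Filter.eventually_congr (.of_forall fun y =>
    variance_condExp_eq_iff h₁₂ h₂ (memLp_tail P hV y 2))

/-- Full explained variance means that the conditional tail is an indicator for almost every level.
The upper level sets are then `m`-measurable up to null sets, first at those levels and then at all
levels by countable unions. -/
theorem explainedVar_eq_top_iff (hV : Measurable V) (hm : m ≤ mΩ) :
    explainedVar m V P = explainedVar mΩ V P ↔ ∃ g : Ω → ℝ, Measurable[m] g ∧ V =ᵐ[P] g := by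
  rw [explainedVar_eq_iff hV hm le_rfl]
  constructor
  · intro h
    refine exists_measurable_ae_eq_of_tail fun y => ?_
    have hgood : ∀ᵐ y ∂(P.map V), ∃ A : Set Ω, MeasurableSet[m] A ∧ {ω | y ≤ V ω} =ᵐ[P] A := by
      filter_upwards [h] with y hy
      -- The conditional tail equals the indicator almost surely, so the set where it is one is an
      -- `m`-measurable version of the event.
      refine ⟨(P⟦{ω | y ≤ V ω} | m⟧) ⁻¹' {1},
        stronglyMeasurable_condExp.measurable (measurableSet_singleton 1), ?_⟩
      rw [condExp_tail_self hV] at hy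
      filter_upwards [hy] with ω hω
      refine propext ?_
      change y ≤ V ω ↔ (P⟦{ω | y ≤ V ω} | m⟧) ω = 1
      rw [← hω]
      by_cases hyV : y ≤ V ω <;> simp [Set.indicator, hyV]
    rcases exists_seq_Ici_of_ae _ hgood y with h0 | ⟨u, -, hD, hnull⟩
    · refine ⟨∅, @MeasurableSet.empty _ m, ?_⟩
      rw [Measure.map_apply hV measurableSet_Ici] at h0
      exact ae_eq_empty.2 h0
    · choose A hA hVA using fun n => (hD n).1
      refine ⟨⋃ n, A n, MeasurableSet.iUnion hA, ?_⟩
      have hU : {ω | y ≤ V ω} =ᵐ[P] ⋃ n, {ω | u n ≤ V ω} := by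
        refine Filter.EventuallyLE.antisymm ?_ ?_
        · rw [ae_le_set]
          rw [Measure.map_apply hV (measurableSet_Ici.diff
            (MeasurableSet.iUnion fun n => measurableSet_Ici))] at hnull
          convert hnull using 2
          ext ω
          simp
        · refine LE.le.eventuallyLE (Set.iUnion_subset fun n ω hω => ?_)
          exact (hD n).2.trans hω
      exact hU.trans (Filter.EventuallyEq.countable_iUnion hVA)
  · rintro ⟨g, hg, hVg⟩
    refine .of_forall fun y => ?_
    rw [condExp_tail_self hV]
    have hae : ({ω | y ≤ V ω}.indicator fun _ => (1 : ℝ)) =ᵐ[P]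
        {ω | y ≤ g ω}.indicator fun _ => (1 : ℝ) := by
      filter_upwards [hVg] with ω hω
      simp [Set.indicator, hω]
    refine (condExp_of_aestronglyMeasurable' hm ⟨_, ?_, hae⟩ (integrable_tail P hV y)).symm
    exact stronglyMeasurable_const.indicator (@hg _ measurableSet_Ici)

theorem explainedVar_bot : explainedVar ⊥ V P = 0 := by
  have hc : ∀ c : ℝ, Var[fun _ : Ω => c; P] = 0 := fun c => by simp [variance, evariance]
  simp [explainedVar, tailVar, condExp_bot, hc]

/-- If it were zero, it would equal the value for the trivial σ-algebra, and `V` would be almost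
surely `⊥`-measurable, that is, constant. -/
theorem explainedVar_pos (hV : Measurable V) (hnd : NonDegenerate V P) :
    0 < explainedVar mΩ V P := by
  refine lt_of_le_of_ne (integral_nonneg fun y => tailVar_nonneg y) fun h => hnd ?_
  obtain ⟨g, hg, hVg⟩ := (explainedVar_eq_top_iff (P := P) hV bot_le).1 (explainedVar_bot.trans h)
  obtain ⟨ω₀⟩ : Nonempty Ω := nonempty_of_isProbabilityMeasure P
  refine ⟨g ω₀, ?_⟩
  filter_upwards [hVg] with ω hω
  rw [hω]
  have hs : MeasurableSet[⊥] (g ⁻¹' {g ω₀}) := hg (measurableSet_singleton _)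
  rcases MeasurableSpace.measurableSet_bot_iff.1 hs with h | h
  · exact ((Set.mem_empty_iff_false ω₀).1 (h ▸ (rfl : ω₀ ∈ g ⁻¹' {g ω₀}))).elim
  · exact (h ▸ Set.mem_univ ω : ω ∈ g ⁻¹' {g ω₀})

theorem xi_eq_div {E : Type*} [mE : MeasurableSpace E] (hV : Measurable V) (W : Ω → E) :
    xi V W P = explainedVar (mE.comap W) V P / explainedVar mΩ V P := by
  simp only [xi, explainedVar, tailVar, condExp_tail_self hV]

variable {E F : Type*} [mE : MeasurableSpace E] [mF : MeasurableSpace F] {W : Ω → E} {X : Ω → F}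

theorem xi_le_one (hV : Measurable V) (hnd : NonDegenerate V P) (hW : Measurable W) :
    xi V W P ≤ 1 := by
  rw [xi_eq_div hV, div_le_one (explainedVar_pos hV hnd)]
  exact explainedVar_mono hV hW.comap_le le_rfl

theorem xi_eq_one_iff (hV : Measurable V) (hnd : NonDegenerate V P) (hW : Measurable W) :
    xi V W P = 1 ↔ ∃ g : E → ℝ, Measurable g ∧ V =ᵐ[P] g ∘ W := by
  rw [xi_eq_div hV, div_eq_one_iff_eq (explainedVar_pos hV hnd).ne',
    explainedVar_eq_top_iff hV hW.comap_le]
  constructor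
  · rintro ⟨g, hg, hVg⟩
    obtain ⟨f, hf, rfl⟩ := hg.exists_eq_measurable_comp
    exact ⟨f, hf, hVg⟩
  · rintro ⟨g, hg, hVg⟩
    exact ⟨g ∘ W, hg.comp (comap_measurable W), hVg⟩

theorem comap_le_comap_prodMk : mE.comap W ≤
    (mF.prod mE).comap fun ω => (X ω, W ω) := by
  rw [MeasurableSpace.comap_prodMk]
  exact le_sup_right

theorem xi_le_xi_prodMk (hV : Measurable V) (hnd : NonDegenerate V P) (hX : Measurable X)
    (hW : Measurable W) : xi V W P ≤ xi V (fun ω => (X ω, W ω)) P := by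
  rw [xi_eq_div hV, xi_eq_div hV]
  exact div_le_div_of_nonneg_right
    (explainedVar_mono hV comap_le_comap_prodMk (hX.prodMk hW).comap_le)
    (explainedVar_pos hV hnd).le

theorem xi_eq_xi_prodMk_iff (hV : Measurable V) (hnd : NonDegenerate V P) (hX : Measurable X)
    (hW : Measurable W) : xi V W P = xi V (fun ω => (X ω, W ω)) P ↔
      ∀ᵐ y ∂(P.map V), P⟦{ω | y ≤ V ω} | (mF.prod mE).comap fun ω => (X ω, W ω)⟧
        =ᵐ[P] P⟦{ω | y ≤ V ω} | mE.comap W⟧ := by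
  rw [xi_eq_div hV, xi_eq_div hV, div_left_inj' (explainedVar_pos hV hnd).ne']
  exact explainedVar_eq_iff hV comap_le_comap_prodMk (hX.prodMk hW).comap_le

end Tail

/-! ### Conditional tails and independence. -/

section Independence

variable {Ω : Type*} {m₁ m₂ mΩ : MeasurableSpace Ω} {P : Measure Ω} [IsProbabilityMeasure P]
  {E F : Type*} [mE : MeasurableSpace E] [mF : MeasurableSpace F] {W : Ω → E} {X : Ω → F}

theorem setIntegral_inter_of_indep (h₁ : m₁ ≤ mΩ) (h₂ : m₂ ≤ mΩ)
    (hind : Indep m₁ m₂ P) {s t : Set Ω} (hs : MeasurableSet[m₁] s) (ht : MeasurableSet[m₂] t)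
    {g : Ω → ℝ} (hg : StronglyMeasurable[m₂] g) (hgi : Integrable g P) :
    ∫ ω in s ∩ t, g ω ∂P = P.real s * ∫ ω in t, g ω ∂P := by
  have hc := condExp_indep_eq h₂ h₁ (hg.indicator ht) hind.symm
  have := setIntegral_condExp h₁ (hgi.indicator (h₂ t ht)) hs
  rw [setIntegral_congr_ae (h₁ s hs) (hc.mono fun ω hω _ => hω), setIntegral_const,
    integral_indicator (h₂ t ht), setIntegral_indicator (h₂ t ht)] at this
  rw [← this, smul_eq_mul]

/-- If `(W, V)` is independent of `X`, then the conditional tail probabilities of `V` given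
`(X, W)` do not depend on `X`. -/
theorem condExp_tail_prodMk_of_indepFun {V : Ω → ℝ} (hV : Measurable V) (hX : Measurable X)
    (hW : Measurable W) (hind : IndepFun X (fun ω => (W ω, V ω)) P) (y : ℝ) :
    P⟦{ω | y ≤ V ω} | (mF.prod mE).comap fun ω => (X ω, W ω)⟧
        =ᵐ[P] P⟦{ω | y ≤ V ω} | mE.comap W⟧ := by
  set f : Ω → ℝ := {ω | y ≤ V ω}.indicator fun _ => (1 : ℝ) with hf
  have hfi : Integrable f P := integrable_tail P hV y
  have hle : mE.comap W ≤ (mE.prod Real.measurableSpace).comap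
      fun ω => (W ω, V ω) := by
    rw [MeasurableSpace.comap_prodMk]
    exact le_sup_left
  have hle' : Real.measurableSpace.comap V ≤
      (mE.prod Real.measurableSpace).comap fun ω => (W ω, V ω) := by
    rw [MeasurableSpace.comap_prodMk]
    exact le_sup_right
  have hfm : StronglyMeasurable[(mE.prod Real.measurableSpace).comap
      fun ω => (W ω, V ω)] f :=
    stronglyMeasurable_const.indicator (hle' _ ⟨Set.Ici y, measurableSet_Ici, rfl⟩)
  have hind' : Indep (mF.comap X) ((mE.prod Real.measurableSpace).comap
      fun ω => (W ω, V ω)) P := hind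
  set g : Ω → ℝ := P[f|mE.comap W] with hg
  have hgi : Integrable g P := integrable_condExp
  have hpair : Measurable fun ω => (X ω, W ω) := hX.prodMk hW
  -- The tail given `W` alone has the defining property of the one given `(X, W)`: on rectangles by
  -- independence, then by a π-λ argument.
  have key : ∀ T : Set (F × E), MeasurableSet T →
      ∫ ω in (fun ω => (X ω, W ω)) ⁻¹' T, g ω ∂P = ∫ ω in (fun ω => (X ω, W ω)) ⁻¹' T, f ω ∂P := by
    intro T hT
    induction T, hT using MeasurableSpace.induction_on_inter generateFrom_prod.symm
      isPiSystem_prod with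
    | empty => simp
    | basic T hT =>
      obtain ⟨A, hA, B, hB, rfl⟩ := hT
      have hpre : (fun ω => (X ω, W ω)) ⁻¹' (A ×ˢ B) = X ⁻¹' A ∩ W ⁻¹' B := rfl
      rw [hpre, setIntegral_inter_of_indep hX.comap_le (hW.prodMk hV).comap_le hind' ⟨A, hA, rfl⟩
        (hle _ ⟨B, hB, rfl⟩) (stronglyMeasurable_condExp.mono hle) hgi,
        setIntegral_inter_of_indep hX.comap_le (hW.prodMk hV).comap_le hind' ⟨A, hA, rfl⟩
        (hle _ ⟨B, hB, rfl⟩) hfm hfi, setIntegral_condExp hW.comap_le hfi ⟨B, hB, rfl⟩]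
    | compl T hT ih =>
      rw [Set.preimage_compl, setIntegral_compl (hpair hT) hgi, setIntegral_compl (hpair hT) hfi,
        ih, integral_condExp hW.comap_le]
    | iUnion T hd hT ih =>
      rw [Set.preimage_iUnion, integral_iUnion (fun i => hpair (hT i))
        (fun i j hij => (hd hij).preimage _) hgi.integrableOn,
        integral_iUnion (fun i => hpair (hT i)) (fun i j hij => (hd hij).preimage _)
          hfi.integrableOn]
      exact tsum_congr ih
  refine (ae_eq_condExp_of_forall_setIntegral_eq hpair.comap_le hfi
    (fun s _ _ => hgi.integrableOn) ?_
    (stronglyMeasurable_condExp.mono comap_le_comap_prodMk).aestronglyMeasurable).symm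
  rintro _ ⟨T, hT, rfl⟩ -
  exact key T hT

/-- If `W` is independent of `X` and the conditional tail probabilities of `V` given `(X, W)` do
not depend on `X`, then `(W, V)` is independent of `X`. -/
theorem indepFun_prodMk_of_condExp_tail {V : Ω → ℝ} (hV : Measurable V) (hX : Measurable X)
    (hW : Measurable W) (hind : IndepFun X W P)
    (h : ∀ᵐ y ∂(P.map V),
      P⟦{ω | y ≤ V ω} | (mF.prod mE).comap fun ω => (X ω, W ω)⟧
        =ᵐ[P] P⟦{ω | y ≤ V ω} | mE.comap W⟧) :
    IndepFun X (fun ω => (W ω, V ω)) P := by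
  have hind' : Indep (mF.comap X) (mE.comap W) P := hind
  have hpair : Measurable fun ω => (X ω, W ω) := hX.prodMk hW
  have key : ∀ A : Set F, MeasurableSet A → ∀ B : Set E, MeasurableSet B →
      (P.restrict (X ⁻¹' A ∩ W ⁻¹' B)).map V = P (X ⁻¹' A) • (P.restrict (W ⁻¹' B)).map V := by
    intro A hA B hB
    have : IsFiniteMeasure ((P.restrict (X ⁻¹' A ∩ W ⁻¹' B)).map V) := inferInstance
    -- The hypothesis covers only almost every level for the law of `V`. Both measures are dominated
    -- by that law, so these levels determine them.
    refine ext_of_ae_Ici (ν := P.map V)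
      (Measure.AbsolutelyContinuous.map Measure.restrict_le_self.absolutelyContinuous hV)
      ((Measure.AbsolutelyContinuous.map
        Measure.restrict_le_self.absolutelyContinuous hV).smul_left _) ?_
    filter_upwards [h] with y hy
    have hfi := integrable_tail P hV y
    have hAB : MeasurableSet (X ⁻¹' A ∩ W ⁻¹' B) := (hX hA).inter (hW hB)
    have h1 := setIntegral_condExp (m := (mF.prod mE).comap fun ω => (X ω, W ω)) hpair.comap_le hfi
      (s := X ⁻¹' A ∩ W ⁻¹' B) ⟨A ×ˢ B, hA.prod hB, rfl⟩
    rw [setIntegral_congr_ae hAB (hy.mono fun ω hω _ => hω),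
      setIntegral_inter_of_indep hX.comap_le hW.comap_le hind' ⟨A, hA, rfl⟩ ⟨B, hB, rfl⟩
        stronglyMeasurable_condExp integrable_condExp,
      setIntegral_condExp hW.comap_le hfi ⟨B, hB, rfl⟩,
      integral_indicator (measurableSet_tail hV y), integral_indicator (measurableSet_tail hV y),
      setIntegral_const, setIntegral_const, smul_eq_mul, smul_eq_mul, mul_one, mul_one] at h1
    rw [Measure.smul_apply, Measure.map_apply hV measurableSet_Ici,
      Measure.map_apply hV measurableSet_Ici, smul_eq_mul]
    refine (ENNReal.toReal_eq_toReal_iff' (measure_ne_top _ _)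
      (ENNReal.mul_ne_top (measure_ne_top _ _) (measure_ne_top _ _))).1 ?_
    rw [ENNReal.toReal_mul]
    exact h1.symm
  have hgen : (mE.prod Real.measurableSpace).comap (fun ω => (W ω, V ω)) =
      MeasurableSpace.generateFrom (Set.preimage (fun ω => (W ω, V ω)) ''
        (Set.image2 (· ×ˢ ·) {s | MeasurableSet s} {t | MeasurableSet t})) := by
    rw [← MeasurableSpace.comap_generateFrom, generateFrom_prod]
    rfl
  refine IndepSets.indep hX.comap_le (hW.prodMk hV).comap_le
    (@MeasurableSpace.isPiSystem_measurableSet _ (mF.comap X))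
    (isPiSystem_prod.comap fun ω => (W ω, V ω))
    (@MeasurableSpace.generateFrom_measurableSet _ (mF.comap X)).symm hgen ?_
  rw [IndepSets_iff]
  rintro _ _ ⟨A, hA, rfl⟩ ⟨_, ⟨B, hB, C, hC, rfl⟩, rfl⟩
  have hk := congrArg (fun μ : Measure ℝ => μ C) (key A hA B hB)
  simp only [Measure.smul_apply, Measure.map_apply hV hC, smul_eq_mul,
    Measure.restrict_apply (hV hC)] at hk
  have e : (fun ω => (W ω, V ω)) ⁻¹' (B ×ˢ C) = V ⁻¹' C ∩ W ⁻¹' B := by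
    ext ω
    simp [and_comm]
  rw [e, ← hk]
  congr 1
  ext ω
  simp only [Set.mem_inter_iff, Set.mem_preimage]
  tauto

end Independence

/-! ### Characterisation of the values 0 and 1 of `T`. -/

section Coefficient

variable {Ω : Type*} [MeasurableSpace Ω] {P : Measure Ω} {p q : ℕ}
  {X : Ω → EuclideanSpace ℝ (Fin p)} {Y : Ω → EuclideanSpace ℝ (Fin q)}

theorem measurable_coord {ι : Type*} (j : ι) {Z : Ω → EuclideanSpace ℝ ι} (hZ : Measurable Z) :
    Measurable fun ω => Z ω j :=
  (measurable_pi_apply j).comp ((WithLp.measurable_ofLp 2 _).comp hZ)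

theorem measurable_preceding (hY : Measurable Y) (i : Fin q) : Measurable (preceding Y i) :=
  measurable_pi_lambda _ fun j => measurable_coord j.1 hY

variable [IsProbabilityMeasure P]

/-- Each summand is at most one, and the first is zero because the first coordinate has no
predecessors. -/
theorem T_denominator_pos (hq : 1 ≤ q) (hY : Measurable Y)
    (hYnd : ∀ j : Fin q, NonDegenerate (fun ω => Y ω j) P) :
    0 < (q : ℝ) - ∑ i : Fin q, xi (fun ω => Y ω i) (preceding Y i) P := by
  have hlt : ∑ i : Fin q, xi (fun ω => Y ω i) (preceding Y i) P < ∑ _i : Fin q, (1 : ℝ) := by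
    refine Finset.sum_lt_sum
      (fun i _ => xi_le_one (measurable_coord i hY) (hYnd i) (measurable_preceding hY i))
      ⟨⟨0, hq⟩, Finset.mem_univ _, ?_⟩
    have : IsEmpty {j : Fin q // j < ⟨0, hq⟩} := ⟨fun j => Nat.not_lt_zero _ j.2⟩
    rw [xi_of_subsingleton]
    exact one_pos
  simp only [Finset.sum_const, Finset.card_univ, Fintype.card_fin, nsmul_eq_mul, mul_one] at hlt
  linarith

theorem T_eq_zero_iff_forall_xi (hq : 1 ≤ q) (hX : Measurable X) (hY : Measurable Y)
    (hYnd : ∀ j : Fin q, NonDegenerate (fun ω => Y ω j) P) :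
    T Y X P = 0 ↔ ∀ i : Fin q, xi (fun ω => Y ω i) (preceding Y i) P =
      xi (fun ω => Y ω i) (fun ω => (X ω, preceding Y i ω)) P := by
  have hpos := T_denominator_pos hq hY hYnd
  have hle : ∀ i ∈ (Finset.univ : Finset (Fin q)), xi (fun ω => Y ω i) (preceding Y i) P ≤
      xi (fun ω => Y ω i) (fun ω => (X ω, preceding Y i ω)) P := fun i _ =>
    xi_le_xi_prodMk (measurable_coord i hY) (hYnd i) hX (measurable_preceding hY i)
  have h := Finset.sum_eq_sum_iff_of_le hle
  simp only [Finset.mem_univ, true_implies] at h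
  rw [← h, T, sub_eq_zero, eq_comm, div_eq_one_iff_eq hpos.ne', sub_right_inj, eq_comm]

theorem T_eq_one_iff_forall_xi (hq : 1 ≤ q) (hX : Measurable X) (hY : Measurable Y)
    (hYnd : ∀ j : Fin q, NonDegenerate (fun ω => Y ω j) P) :
    T Y X P = 1 ↔
      ∀ i : Fin q, xi (fun ω => Y ω i) (fun ω => (X ω, preceding Y i ω)) P = 1 := by
  have hpos := T_denominator_pos hq hY hYnd
  have hle : ∀ i ∈ (Finset.univ : Finset (Fin q)),
      xi (fun ω => Y ω i) (fun ω => (X ω, preceding Y i ω)) P ≤ 1 := fun i _ =>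
    xi_le_one (measurable_coord i hY) (hYnd i) (hX.prodMk (measurable_preceding hY i))
  have h := Finset.sum_eq_sum_iff_of_le hle
  simp only [Finset.mem_univ, true_implies, Finset.sum_const, Finset.card_univ, Fintype.card_fin,
    nsmul_eq_mul, mul_one] at h
  rw [← h, T, sub_eq_self, div_eq_zero_iff, or_iff_left hpos.ne', sub_eq_zero, eq_comm]

/-- The rank correlation `T` vanishes exactly for independent vectors. -/
theorem T_eq_zero_iff_indepFun (hq : 1 ≤ q) (hX : Measurable X) (hY : Measurable Y)
    (hYnd : ∀ j : Fin q, NonDegenerate (fun ω => Y ω j) P) :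
    T Y X P = 0 ↔ IndepFun X Y P := by
  have hxi := fun i : Fin q => xi_eq_xi_prodMk_iff (measurable_coord i hY) (hYnd i) hX
    (measurable_preceding hY i)
  rw [T_eq_zero_iff_forall_xi hq hX hY hYnd]
  constructor
  · intro h
    -- Independence from the predecessors is passed on to the next coordinate; the maps `G` below
    -- only regroup coordinates.
    have hstep : ∀ i : Fin q, IndepFun X (preceding Y i) P →
        IndepFun X (fun ω => (preceding Y i ω, Y ω i)) P := fun i hi =>
      indepFun_prodMk_of_condExp_tail (measurable_coord i hY) hX (measurable_preceding hY i) hi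
        ((hxi i).1 (h i))
    have hpre : ∀ k : ℕ, ∀ hk : k < q, IndepFun X (preceding Y ⟨k, hk⟩) P := by
      intro k
      induction k with
      | zero =>
        intro hk
        have : IsEmpty {j : Fin q // j < ⟨0, hk⟩} := ⟨fun j => Nat.not_lt_zero _ j.2⟩
        rw [show preceding Y ⟨0, hk⟩ = fun _ => isEmptyElim from
          funext fun ω => Subsingleton.elim _ _]
        exact indepFun_const_right _ _
      | succ k ih =>
        intro hk
        have hk' : k < q := Nat.lt_of_succ_lt hk
        let G : ({j : Fin q // j < ⟨k, hk'⟩} → ℝ) × ℝ → ({j : Fin q // j < ⟨k + 1, hk⟩} → ℝ) :=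
          fun w j => if hj : j.1 < ⟨k, hk'⟩ then w.1 ⟨j.1, hj⟩ else w.2
        have hG : Measurable G := by
          refine measurable_pi_lambda _ fun j => ?_
          by_cases hj : j.1 < ⟨k, hk'⟩
          · simpa only [G, hj, dif_pos] using! (measurable_pi_apply _).comp measurable_fst
          · simpa only [G, hj, dif_neg, not_false_iff] using! measurable_snd
        have heq : preceding Y ⟨k + 1, hk⟩ =
            G ∘ fun ω => (preceding Y ⟨k, hk'⟩ ω, Y ω ⟨k, hk'⟩) := by
          funext ω j
          by_cases hj : j.1 < ⟨k, hk'⟩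
          · simp [G, hj, preceding]
          · have hjk : j.1 = ⟨k, hk'⟩ := by
              have h1 : j.1.val < k + 1 := j.2
              have h2 : ¬ j.1.val < k := hj
              exact Fin.ext (by simp only; omega)
            simp [G, preceding, hjk]
        rw [heq]
        exact (hstep _ (ih hk')).comp measurable_id hG
    have hlast : q - 1 < q := by omega
    let G : ({j : Fin q // j < ⟨q - 1, hlast⟩} → ℝ) × ℝ → EuclideanSpace ℝ (Fin q) :=
      fun w => WithLp.toLp 2 fun j => if hj : j < ⟨q - 1, hlast⟩ then w.1 ⟨j, hj⟩ else w.2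
    have hG : Measurable G := by
      refine (WithLp.measurable_toLp 2 _).comp (measurable_pi_lambda _ fun j => ?_)
      by_cases hj : j < ⟨q - 1, hlast⟩
      · simpa only [hj, dif_pos] using! (measurable_pi_apply _).comp measurable_fst
      · simpa only [hj, dif_neg, not_false_iff] using! measurable_snd
    have heq : Y = G ∘ fun ω => (preceding Y ⟨q - 1, hlast⟩ ω, Y ω ⟨q - 1, hlast⟩) := by
      funext ω
      ext j
      by_cases hj : j < ⟨q - 1, hlast⟩
      · simp [G, hj, preceding]
      · have hjk : j = ⟨q - 1, hlast⟩ := by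
          have h2 : ¬ j.val < q - 1 := hj
          exact Fin.ext (by simp only; omega)
        simp [G, hjk]
    rw [heq]
    exact (hstep _ (hpre _ hlast)).comp measurable_id hG
  · intro h i
    refine (hxi i).2 (.of_forall fun y => ?_)
    refine condExp_tail_prodMk_of_indepFun (measurable_coord i hY) hX (measurable_preceding hY i)
      ?_ y
    let G : EuclideanSpace ℝ (Fin q) → ({j : Fin q // j < i} → ℝ) × ℝ :=
      fun w => (fun j : {j : Fin q // j < i} => w j.1, w i)
    have hG : Measurable G :=
      (measurable_pi_lambda _ fun j : {j : Fin q // j < i} => measurable_coord j.1 measurable_id).prodMk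
        (measurable_coord i measurable_id)
    exact h.comp measurable_id hG

/-- The rank correlation `T` equals one exactly if `Y` is almost surely a function of `X`. -/
theorem T_eq_one_iff_exists_measurable (hq : 1 ≤ q) (hX : Measurable X) (hY : Measurable Y)
    (hYnd : ∀ j : Fin q, NonDegenerate (fun ω => Y ω j) P) :
    T Y X P = 1 ↔ ∃ f : EuclideanSpace ℝ (Fin p) → EuclideanSpace ℝ (Fin q),
      Measurable f ∧ Y =ᵐ[P] f ∘ X := by
  have hxi := fun i : Fin q => xi_eq_one_iff (measurable_coord i hY) (hYnd i)
    (hX.prodMk (measurable_preceding hY i))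
  rw [T_eq_one_iff_forall_xi hq hX hY hYnd]
  constructor
  · intro h
    have hf : ∀ i : Fin q, ∃ f : EuclideanSpace ℝ (Fin p) → ℝ, Measurable f ∧
        (fun ω => Y ω i) =ᵐ[P] f ∘ X := by
      intro i
      -- By strong induction the predecessors are themselves functions of `X` and can be substituted
      -- into `g`.
      induction i using WellFoundedLT.induction with
      | ind i ih =>
        obtain ⟨g, hg, hYg⟩ := (hxi i).1 (h i)
        choose f hfm hfY using fun j : {j : Fin q // j < i} => ih j.1 j.2
        refine ⟨fun x => g (x, fun j => f j x),
          hg.comp (measurable_id.prodMk (measurable_pi_lambda _ hfm)), ?_⟩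
        filter_upwards [hYg, ae_all_iff.2 hfY] with ω h1 h2
        rw [h1]
        exact congrArg (fun w => g (X ω, w)) (funext fun j => h2 j)
    choose f hfm hfY using hf
    refine ⟨fun x => WithLp.toLp 2 fun i => f i x,
      (WithLp.measurable_toLp 2 _).comp (measurable_pi_lambda _ hfm), ?_⟩
    filter_upwards [ae_all_iff.2 hfY] with ω hω
    ext i
    exact hω i
  · rintro ⟨f, hf, hYf⟩ i
    refine (hxi i).2 ⟨fun w => f w.1 i, measurable_coord i (hf.comp measurable_fst), ?_⟩
    filter_upwards [hYf] with ω hω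
    rw [hω]
    rfl

end Coefficient

/-! ### Kernels, blocks and rank of positive semi-definite matrices. -/

section LinearAlgebra

/-- A matrix whose kernel contains the kernel of `M` is a left multiple of `M`. -/
theorem exists_eq_mul_of_ker_le {a b n : Type*} [Fintype a] [Fintype n] {M : Matrix a n ℝ}
    {N : Matrix b n ℝ} (h : ∀ x, M *ᵥ x = 0 → N *ᵥ x = 0) : ∃ A : Matrix b a ℝ, N = A * M := by
  classical
  have hrow : ∀ i, ∃ c : a → ℝ, ∀ k, N i k = ∑ j, c j * M j k := by
    intro i
    -- A functional vanishing on the common kernel of finitely many functionals lies in their span;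
    -- here these are the rows.
    have hmem : (Matrix.mulVecLin (Matrix.of fun (_ : Unit) k => N i k)).dualMap
        (LinearMap.proj ()) ∈ Submodule.span ℝ (Set.range fun j : a =>
          (Matrix.mulVecLin M).dualMap (LinearMap.proj j)) := by
      refine mem_span_of_iInf_ker_le_ker fun x hx => ?_
      have hMx : M *ᵥ x = 0 := by
        ext j
        exact (Submodule.mem_iInf _).1 hx j
      exact congrFun (h x hMx) i
    obtain ⟨c, hc⟩ := (Submodule.mem_span_range_iff_exists_fun ℝ).1 hmem
    refine ⟨c, fun k => ?_⟩
    have := congrArg (fun L => L (Pi.single k 1)) hc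
    simpa using this.symm
  choose c hc using hrow
  exact ⟨Matrix.of c, by ext i k; simp [Matrix.mul_apply, hc i k]⟩

variable {p q : Type*} {S : Matrix (p ⊕ q) (p ⊕ q) ℝ}

theorem toBlocks₁₂_eq_transpose (hS : S.PosSemidef) : S.toBlocks₁₂ = S.toBlocks₂₁ᵀ := by
  ext i j
  exact (hS.isHermitian.apply (Sum.inl i) (Sum.inr j)).symm

variable [Fintype p] [Fintype q]

/-- If `S₁₁ x = 0`, the quadratic form vanishes at `(x, 0)`, so `S` itself kills this vector and
`S₂₁ x = 0`. This replaces inverting a possibly singular `S₁₁`. -/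
theorem exists_toBlocks₂₁_eq_mul (hS : S.PosSemidef) :
    ∃ A : Matrix q p ℝ, S.toBlocks₂₁ = A * S.toBlocks₁₁ := by
  refine exists_eq_mul_of_ker_le fun x hx => ?_
  have hSx : S *ᵥ Sum.elim x 0 = Sum.elim (S.toBlocks₁₁ *ᵥ x) (S.toBlocks₂₁ *ᵥ x) := by
    conv_lhs => rw [← Matrix.fromBlocks_toBlocks S]
    simp [Matrix.fromBlocks_mulVec]
  have h0 : S *ᵥ Sum.elim x 0 = 0 := by
    refine (hS.dotProduct_mulVec_zero_iff _).1 ?_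
    rw [hSx, hx]
    simp [dotProduct]
  ext j
  have := congrFun (hSx.symm.trans h0) (Sum.inr j)
  simpa using this

/-- The rank of a positive semi-definite block matrix equals the rank of its upper left block
exactly if its lower rows are linear combinations of its upper rows. -/
theorem rank_eq_rank_toBlocks₁₁_iff (hS : S.PosSemidef) : S.rank = S.toBlocks₁₁.rank ↔
    ∃ A : Matrix q p ℝ, S.toBlocks₂₁ = A * S.toBlocks₁₁ ∧ S.toBlocks₂₂ = A * S.toBlocks₁₂ := by
  classical
  set B : Matrix p (p ⊕ q) ℝ := Matrix.fromCols S.toBlocks₁₁ S.toBlocks₁₂ with hB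
  have hBS : B = (Matrix.fromCols 1 0 : Matrix p (p ⊕ q) ℝ) * S := by
    conv_rhs => rw [← Matrix.fromBlocks_toBlocks S]
    simp [hB, Matrix.fromCols_mul_fromBlocks]
  have h11B : S.toBlocks₁₁ = B * (Matrix.fromRows 1 0 : Matrix (p ⊕ q) p ℝ) := by
    simp [hB, Matrix.fromCols_mul_fromRows]
  have hB_le : B.rank ≤ S.rank := hBS ▸ Matrix.rank_mul_le_right _ _
  have h11_le : S.toBlocks₁₁.rank ≤ B.rank := by
    rw [h11B]
    exact Matrix.rank_mul_le_left _ _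
  constructor
  · intro h
    have hrank : B.rank = S.rank := le_antisymm hB_le (h ▸ h11_le)
    have hker : LinearMap.ker S.mulVecLin ≤ LinearMap.ker B.mulVecLin := by
      intro x hx
      have hx' : S *ᵥ x = 0 := hx
      change B *ᵥ x = 0
      rw [hBS, ← Matrix.mulVec_mulVec, hx', Matrix.mulVec_zero]
    have h1 := LinearMap.finrank_range_add_finrank_ker S.mulVecLin
    have h2 := LinearMap.finrank_range_add_finrank_ker B.mulVecLin
    rw [Matrix.rank, Matrix.rank] at hrank
    -- `B` consists of the upper rows of `S`. Equal ranks make the nested kernels equal, so all rows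
    -- of `S` are combinations of rows of `B`.
    have heq := Submodule.eq_of_le_of_finrank_eq hker (by omega)
    obtain ⟨D, hD⟩ := exists_eq_mul_of_ker_le (M := B) (N := S) fun x hx => by
      have : x ∈ LinearMap.ker S.mulVecLin := heq ▸ hx
      exact this
    have hDk : ∀ j k, S (Sum.inr j) k = ∑ i, D (Sum.inr j) i * B i k := fun j k => by
      conv_lhs => rw [hD]
      rfl
    refine ⟨Matrix.of fun j i => D (Sum.inr j) i, ?_, ?_⟩
    · ext j k
      exact hDk j (Sum.inl k)
    · ext j k
      exact hDk j (Sum.inr k)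
  · rintro ⟨A, h21, h22⟩
    have h12 : S.toBlocks₁₂ = S.toBlocks₁₁ * Aᵀ := by
      have hsymm : S.toBlocks₁₁ᵀ = S.toBlocks₁₁ := by
        ext i j
        exact hS.isHermitian.apply (Sum.inl i) (Sum.inl j)
      rw [toBlocks₁₂_eq_transpose hS, h21, Matrix.transpose_mul, hsymm]
    have hSB : S = (Matrix.fromRows 1 A : Matrix (p ⊕ q) p ℝ) * B := by
      conv_lhs => rw [← Matrix.fromBlocks_toBlocks S, h21, h22]
      simp [hB]
    have hB11 : B = S.toBlocks₁₁ * (Matrix.fromCols 1 Aᵀ : Matrix p (p ⊕ q) ℝ) := by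
      rw [hB, h12, Matrix.mul_fromCols, Matrix.mul_one]
    refine le_antisymm ?_ (h11_le.trans hB_le)
    calc S.rank ≤ B.rank := by
          conv_lhs => rw [hSB]
          exact Matrix.rank_mul_le_right _ _
      _ ≤ S.toBlocks₁₁.rank := by
          conv_lhs => rw [hB11]
          exact Matrix.rank_mul_le_left _ _

end LinearAlgebra

/-! ### Functional equations for the generator. -/

section FunctionalEquation

/-- A bounded continuous solution of the exponential functional equation on `[0, ∞)` with value
`1` at the origin is a decreasing exponential. -/
theorem exists_eq_exp_of_map_add {φ : ℝ≥0 → ℝ} (hc : Continuous φ) (h0 : φ 0 = 1)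
    (hb : ∀ x, φ x ≤ 1) (hadd : ∀ x y, φ (x + y) = φ x * φ y) :
    ∃ k : ℝ, 0 ≤ k ∧ ∀ x : ℝ≥0, φ x = Real.exp (-(k * x)) := by
  have hhalf : ∀ x, φ x = φ (x / 2) ^ 2 := fun x => by
    rw [sq, ← hadd, add_halves]
  -- A zero at `x` would propagate to every `x / 2 ^ n`, against continuity and `φ 0 = 1`.
  have hne : ∀ x, φ x ≠ 0 := by
    intro x hx
    have hn : ∀ n : ℕ, φ (x / 2 ^ n) = 0 := by
      intro n
      induction n with
      | zero => simpa using hx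
      | succ n ih =>
        rw [hhalf] at ih
        rw [pow_succ, ← div_div]
        exact pow_eq_zero_iff two_ne_zero |>.1 ih
    have hlim : Filter.Tendsto (fun n : ℕ => x / 2 ^ n) Filter.atTop (nhds 0) := by
      rw [← NNReal.tendsto_coe]
      simpa using tendsto_const_nhds.div_atTop (a := (x : ℝ))
        (tendsto_pow_atTop_atTop_of_one_lt (one_lt_two : (1 : ℝ) < 2))
    have := (hc.tendsto 0).comp hlim
    rw [h0] at this
    have h00 : φ ∘ (fun n : ℕ => x / 2 ^ n) = fun _ => 0 := funext hn
    rw [h00] at this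
    exact zero_ne_one (tendsto_nhds_unique tendsto_const_nhds this)
  have hpos : ∀ x, 0 < φ x := fun x =>
    lt_of_le_of_ne (hhalf x ▸ sq_nonneg _) (hne x).symm
  let f : ℝ≥0 → ℝ := fun x => Real.log (φ x)
  have hf : ∀ x y, f (x + y) = f x + f y := fun x y => by
    simp only [f, hadd, Real.log_mul (hne x) (hne y)]
  have hfc : Continuous f := hc.log hne
  -- The odd extension of `log φ` to the line is additive and continuous, hence linear.
  let L : ℝ →+ ℝ := AddMonoidHom.mk' (fun x => f x.toNNReal - f (-x).toNNReal) fun x y => by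
    have h1 : (x + y).toNNReal + ((-x).toNNReal + (-y).toNNReal) =
        (-(x + y)).toNNReal + (x.toNNReal + y.toNNReal) := by
      apply NNReal.coe_injective
      simp only [NNReal.coe_add, Real.coe_toNNReal']
      rcases max_cases (x + y) 0 with h | h <;> rcases max_cases (-(x + y)) 0 with h' | h' <;>
        rcases max_cases x 0 with h'' | h'' <;> rcases max_cases (-x) 0 with h3 | h3 <;>
        rcases max_cases y 0 with h4 | h4 <;> rcases max_cases (-y) 0 with h5 | h5 <;>
        linarith
    have h2 := congrArg f h1
    simp only [hf] at h2
    linarith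
  have hLc : Continuous L :=
    (hfc.comp continuous_real_toNNReal).sub (hfc.comp (continuous_real_toNNReal.comp continuous_neg))
  have hL : ∀ x : ℝ≥0, f x = x * f 1 := by
    intro x
    have hsmul := (L.toRealLinearMap hLc).map_smul (x : ℝ) 1
    have hval : ∀ y : ℝ≥0, L (y : ℝ) = f y := fun y => by
      have hf0 : f 0 = 0 := by simp [f, h0]
      have hy : (-(y : ℝ)).toNNReal = 0 := Real.toNNReal_of_nonpos (by simp)
      change f (y : ℝ).toNNReal - f (-(y : ℝ)).toNNReal = f y
      rw [hy, hf0, Real.toNNReal_coe, sub_zero]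
    rw [smul_eq_mul, mul_one, AddMonoidHom.coe_toRealLinearMap, hval, smul_eq_mul] at hsmul
    rw [hsmul, ← hval 1, NNReal.coe_one]
  refine ⟨-f 1, neg_nonneg.2 (Real.log_nonpos (hpos 1).le (hb 1)), fun x => ?_⟩
  rw [neg_mul, neg_neg, mul_comm, ← hL, Real.exp_log (hpos x)]

/-- If a continuous non-constant `φ` turns the quadratic form with coefficients `a`, `c`, `b` into
a product, then the mixed coefficient `c` vanishes. -/
theorem mixed_coeff_eq_zero {φ : ℝ≥0 → ℝ} (hc : Continuous φ) (h0 : φ 0 = 1)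
    (hne : ∃ r, φ r ≠ 1) {a b c : ℝ} (ha : 0 < a) (hb : 0 < b)
    (h : ∀ s t : ℝ, φ (s ^ 2 * a + 2 * (s * t) * c + t ^ 2 * b).toNNReal =
      φ (s ^ 2 * a).toNNReal * φ (t ^ 2 * b).toNNReal) : c = 0 := by
  by_contra hc0
  obtain ⟨z, hz⟩ := hne
  set d := √(a * b) with hd
  have hdpos : 0 < d := Real.sqrt_pos.2 (mul_pos ha hb)
  have hdd : d ^ 2 = a * b := Real.sq_sqrt (mul_pos ha hb).le
  have hcpos : 0 < |c| := abs_pos.2 hc0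
  -- Taking `s = √(y b)` and `t = ±√(y a)` gives the same right-hand side for both signs, while the
  -- left arguments are `2 y d (d ± c)`.
  have hsymm : ∀ x : ℝ, 0 ≤ x → φ (x * (d + c)).toNNReal = φ (x * (d - c)).toNNReal := by
    intro x hx
    set y := x / (2 * d) with hy
    have hy0 : 0 ≤ y := by positivity
    have hst : √(y * b) * √(y * a) = y * d := by
      rw [← Real.sqrt_mul (by positivity), show y * b * (y * a) = y ^ 2 * (a * b) by ring,
        Real.sqrt_mul (by positivity), Real.sqrt_sq hy0]
    have hs2 : √(y * b) ^ 2 = y * b := Real.sq_sqrt (by positivity)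
    have ht2 : √(y * a) ^ 2 = y * a := Real.sq_sqrt (by positivity)
    have hyx : y * (2 * d) = x := by
      rw [hy]
      field_simp
    have h1 := h √(y * b) √(y * a)
    have h2 := h √(y * b) (-√(y * a))
    rw [mul_neg, neg_sq, hst, hs2, ht2] at h2
    rw [hst, hs2, ht2] at h1
    have e1 : y * b * a + 2 * (y * d) * c + y * a * b = x * (d + c) := by
      rw [← hyx]
      linear_combination -2 * y * hdd
    have e2 : y * b * a + 2 * -(y * d) * c + y * a * b = x * (d - c) := by
      rw [← hyx]
      linear_combination -2 * y * hdd
    rw [e1] at h1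
    rw [e2] at h2
    rw [h1, h2]
  have habs : ∀ x : ℝ, 0 ≤ x → φ (x * (d + |c|)).toNNReal = φ (x * (d - |c|)).toNNReal := by
    intro x hx
    rcases abs_choice c with hcc | hcc
    · rw [hcc]
      exact hsymm x hx
    · rw [hcc, sub_neg_eq_add, ← sub_eq_add_neg]
      exact (hsymm x hx).symm
  -- Invariance of `φ` under scaling by `l < 1` forces `φ = φ 0`. If `|c| > d`, truncation gives `l
  -- = 0`, so no Cauchy–Schwarz bound is needed.
  set l : ℝ≥0 := ((d - |c|) / (d + |c|)).toNNReal with hl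
  have hl1 : l < 1 := by
    rw [hl, Real.toNNReal_lt_one, div_lt_one (by positivity)]
    linarith
  have hscale : ∀ x : ℝ≥0, φ x = φ (x * l) := by
    intro x
    have hx := habs (x / (d + |c|)) (by positivity)
    rw [div_mul_cancel₀ _ (by positivity), Real.toNNReal_coe, div_mul_eq_mul_div,
      mul_div_assoc (x : ℝ),
      Real.toNNReal_mul x.coe_nonneg, Real.toNNReal_coe] at hx
    exact hx
  have hiter : ∀ n : ℕ, φ z = φ (z * l ^ n) := by
    intro n
    induction n with
    | zero => simp
    | succ n ih => rw [ih, hscale, pow_succ, mul_assoc]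
  have hlim : Filter.Tendsto (fun n : ℕ => z * l ^ n) Filter.atTop (nhds (z * 0)) :=
    (NNReal.tendsto_pow_atTop_nhds_zero_of_lt_one hl1).const_mul z
  rw [mul_zero] at hlim
  have hlim' := (hc.tendsto 0).comp hlim
  have hconst : φ ∘ (fun n : ℕ => z * l ^ n) = fun _ => φ z := funext fun n => (hiter n).symm
  rw [hconst, h0] at hlim'
  exact hz (tendsto_nhds_unique tendsto_const_nhds hlim')

end FunctionalEquation

/-! ### Linear forms and symmetries of elliptical vectors. -/

section Elliptical

variable {ι : Type*} [Fintype ι]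

/-- The quadratic form of the matrix `S`. -/
def quadForm (S : Matrix ι ι ℝ) (t : ι → ℝ) : ℝ := t ⬝ᵥ (S *ᵥ t)

theorem quadForm_smul (S : Matrix ι ι ℝ) (u : ℝ) (t : ι → ℝ) :
    quadForm S (u • t) = u ^ 2 * quadForm S t := by
  simp only [quadForm, Matrix.mulVec_smul, smul_dotProduct, dotProduct_smul, smul_eq_mul]
  ring

theorem quadForm_nonneg {S : Matrix ι ι ℝ} (hS : S.PosSemidef) (t : ι → ℝ) : 0 ≤ quadForm S t := by
  simpa [quadForm] using hS.dotProduct_mulVec_nonneg t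

theorem quadForm_eq_zero_iff {S : Matrix ι ι ℝ} (hS : S.PosSemidef) (t : ι → ℝ) :
    quadForm S t = 0 ↔ S *ᵥ t = 0 := by
  simpa [quadForm] using hS.dotProduct_mulVec_zero_iff t

theorem quadForm_vecMul {S M : Matrix ι ι ℝ} (hM : M * S * Mᵀ = S) (t : ι → ℝ) :
    quadForm S (t ᵥ* M) = quadForm S t := by
  rw [quadForm, quadForm, ← Matrix.mulVec_transpose, Matrix.mulVec_mulVec,
    Matrix.mulVec_transpose, ← Matrix.dotProduct_mulVec, Matrix.mulVec_mulVec, ← Matrix.mul_assoc,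
    hM]

variable {Ω : Type*} [MeasurableSpace Ω] {P : Measure Ω} {Z : Ω → EuclideanSpace ℝ ι}
  {m : EuclideanSpace ℝ ι} {S : Matrix ι ι ℝ} {φ : ℝ≥0 → ℝ}

theorem measurable_dotProduct (hZ : Measurable Z) (m : EuclideanSpace ℝ ι) (t : ι → ℝ) :
    Measurable fun ω => t ⬝ᵥ (Z ω - m).ofLp :=
  Finset.measurable_sum _ fun i _ => ((measurable_coord i hZ).sub_const (m i)).const_mul (t i)

/-- The characteristic function of a linear form of a centred elliptical vector. -/
theorem IsElliptical.charFun_dotProduct (hell : IsElliptical Z P m S φ) (hZ : Measurable Z)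
    (t : ι → ℝ) (u : ℝ) : charFun (P.map fun ω => t ⬝ᵥ (Z ω - m).ofLp) u =
      (φ (u ^ 2 * quadForm S t).toNNReal : ℂ) := by
  have h := hell.2 (WithLp.toLp 2 (u • t))
  rw [← quadForm_smul, quadForm]
  rw [← h, charFun_apply, charFun_apply,
    integral_map (measurable_dotProduct hZ m t).aemeasurable (by fun_prop),
    integral_map (hZ.sub_const m).aemeasurable (by fun_prop)]
  congr with ω
  congr 3
  simp [EuclideanSpace.inner_eq_star_dotProduct, mul_sub]

theorem IsElliptical.apply_zero [IsProbabilityMeasure P] (hell : IsElliptical Z P m S φ)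
    (hZ : Measurable Z) : φ 0 = 1 := by
  have : IsProbabilityMeasure (P.map fun ω => (0 : ι → ℝ) ⬝ᵥ (Z ω - m).ofLp) :=
    Measure.isProbabilityMeasure_map (measurable_dotProduct hZ m 0).aemeasurable
  have h := hell.charFun_dotProduct hZ 0 0
  rw [charFun_zero] at h
  simpa using h.symm

/-- A linear form of a centred elliptical vector vanishes almost surely exactly if the generator
is equal to one on the corresponding ray. -/
theorem IsElliptical.dotProduct_ae_eq_zero_iff [IsProbabilityMeasure P]
    (hell : IsElliptical Z P m S φ) (hZ : Measurable Z) (t : ι → ℝ) :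
    (∀ᵐ ω ∂P, t ⬝ᵥ (Z ω - m).ofLp = 0) ↔ ∀ u : ℝ, φ (u ^ 2 * quadForm S t).toNNReal = 1 := by
  have hm := measurable_dotProduct hZ m t
  have hprob : IsProbabilityMeasure (P.map fun ω => t ⬝ᵥ (Z ω - m).ofLp) :=
    Measure.isProbabilityMeasure_map hm.aemeasurable
  constructor
  · intro h u
    have hcf := hell.charFun_dotProduct hZ t u
    have hae : (fun ω => t ⬝ᵥ (Z ω - m).ofLp) =ᵐ[P] fun _ => 0 := h
    rw [Measure.map_congr hae, Measure.map_const, measure_univ, one_smul, charFun_dirac] at hcf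
    simp only [inner_zero_left, Complex.ofReal_zero, zero_mul, Complex.exp_zero] at hcf
    exact_mod_cast hcf.symm
  · intro h
    have hdirac : P.map (fun ω => t ⬝ᵥ (Z ω - m).ofLp) = Measure.dirac 0 := by
      refine Measure.ext_of_charFun (funext fun u => ?_)
      rw [hell.charFun_dotProduct hZ, h u, charFun_dirac]
      simp
    refine ae_of_ae_map hm.aemeasurable (p := fun x => x = 0) ?_
    rw [hdirac, ae_dirac_eq]
    rfl

theorem IsElliptical.dotProduct_ae_eq_zero_of_quadForm [IsProbabilityMeasure P]
    (hell : IsElliptical Z P m S φ) (hZ : Measurable Z) {t : ι → ℝ} (ht : quadForm S t = 0) :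
    ∀ᵐ ω ∂P, t ⬝ᵥ (Z ω - m).ofLp = 0 := by
  rw [hell.dotProduct_ae_eq_zero_iff hZ]
  intro u
  simpa [ht] using hell.apply_zero hZ

/-- If the form were positive, `u ^ 2 * quadForm S t` would sweep out the whole half-line and `φ`
would be constantly one. -/
theorem IsElliptical.quadForm_eq_zero_of_ae [IsProbabilityMeasure P]
    (hell : IsElliptical Z P m S φ) (hZ : Measurable Z) (hne : ∃ r, φ r ≠ 1) {t : ι → ℝ}
    (h : ∀ᵐ ω ∂P, t ⬝ᵥ (Z ω - m).ofLp = 0) : quadForm S t = 0 := by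
  rw [hell.dotProduct_ae_eq_zero_iff hZ] at h
  by_contra h0
  have hpos : 0 < quadForm S t := lt_of_le_of_ne (quadForm_nonneg hell.1 t) (Ne.symm h0)
  obtain ⟨r, hr⟩ := hne
  refine hr ?_
  have := h (√(r / quadForm S t))
  rwa [Real.sq_sqrt (by positivity), div_mul_cancel₀ _ h0, Real.toNNReal_coe] at this

/-- Along a direction with positive quadratic form, `φ x` is a one-dimensional characteristic
function at `√(x / quadForm S t)`. The same substitution gives continuity. -/
theorem IsElliptical.le_one [IsProbabilityMeasure P]
    (hell : IsElliptical Z P m S φ) (hZ : Measurable Z) {t : ι → ℝ} (ht : 0 < quadForm S t)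
    (x : ℝ≥0) : φ x ≤ 1 := by
  have hprob : IsProbabilityMeasure (P.map fun ω => t ⬝ᵥ (Z ω - m).ofLp) :=
    Measure.isProbabilityMeasure_map (measurable_dotProduct hZ m t).aemeasurable
  have h := norm_charFun_le_one (μ := P.map fun ω => t ⬝ᵥ (Z ω - m).ofLp) (√(x / quadForm S t))
  rw [hell.charFun_dotProduct hZ, Real.sq_sqrt (by positivity), div_mul_cancel₀ _ ht.ne',
    Real.toNNReal_coe, Complex.norm_real] at h
  exact (le_abs_self _).trans h

theorem IsElliptical.continuous [IsProbabilityMeasure P]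
    (hell : IsElliptical Z P m S φ) (hZ : Measurable Z) {t : ι → ℝ} (ht : 0 < quadForm S t) :
    Continuous φ := by
  have hprob : IsProbabilityMeasure (P.map fun ω => t ⬝ᵥ (Z ω - m).ofLp) :=
    Measure.isProbabilityMeasure_map (measurable_dotProduct hZ m t).aemeasurable
  have h : φ = fun x : ℝ≥0 =>
      (charFun (P.map fun ω => t ⬝ᵥ (Z ω - m).ofLp) (√(x / quadForm S t))).re := by
    funext x
    rw [hell.charFun_dotProduct hZ, Real.sq_sqrt (by positivity), div_mul_cancel₀ _ ht.ne',
      Real.toNNReal_coe, Complex.ofReal_re]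
  rw [h]
  exact Complex.continuous_re.comp (continuous_charFun.comp
    (Real.continuous_sqrt.comp (NNReal.continuous_coe.div_const _)))

theorem IsElliptical.map_mul_of_indepFun [IsProbabilityMeasure P]
    (hell : IsElliptical Z P m S φ) (hZ : Measurable Z) {s t : ι → ℝ}
    (hind : IndepFun (fun ω => s ⬝ᵥ (Z ω - m).ofLp) (fun ω => t ⬝ᵥ (Z ω - m).ofLp) P) :
    φ (quadForm S (s + t)).toNNReal = φ (quadForm S s).toNNReal * φ (quadForm S t).toNNReal := by
  have h := congrFun (hind.charFun_map_fun_add_eq_mul (measurable_dotProduct hZ m s).aemeasurable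
    (measurable_dotProduct hZ m t).aemeasurable) 1
  simp only [← add_dotProduct, Pi.mul_apply, hell.charFun_dotProduct hZ, one_pow, one_mul] at h
  exact_mod_cast h

/-- A linear map preserving the scale matrix preserves the law of the centred vector. -/
theorem IsElliptical.map_mulVec [IsProbabilityMeasure P]
    (hell : IsElliptical Z P m S φ) (hZ : Measurable Z) {M : Matrix ι ι ℝ}
    (hM : M * S * Mᵀ = S) :
    P.map (fun ω => WithLp.toLp 2 (M *ᵥ (Z ω - m).ofLp)) = P.map fun ω => Z ω - m := by
  have hMm : Measurable fun ω => (WithLp.toLp 2 (M *ᵥ (Z ω - m).ofLp) : EuclideanSpace ℝ ι) :=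
    (WithLp.measurable_toLp 2 _).comp (measurable_pi_lambda _ fun i =>
      measurable_dotProduct hZ m (M i))
  have h1 : IsProbabilityMeasure (P.map fun ω => Z ω - m) :=
    Measure.isProbabilityMeasure_map (hZ.sub_const m).aemeasurable
  have h2 : IsProbabilityMeasure (P.map fun ω =>
      (WithLp.toLp 2 (M *ᵥ (Z ω - m).ofLp) : EuclideanSpace ℝ ι)) :=
    Measure.isProbabilityMeasure_map hMm.aemeasurable
  refine Measure.ext_of_charFun (funext fun t => ?_)
  have h := hell.charFun_dotProduct hZ (t.ofLp ᵥ* M) 1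
  rw [one_pow, one_mul, quadForm_vecMul hM, quadForm, ← hell.2 t] at h
  rw [← h, charFun_apply, charFun_apply, integral_map hMm.aemeasurable (by fun_prop),
    integral_map (measurable_dotProduct hZ m _).aemeasurable (by fun_prop)]
  congr with ω
  congr 3
  simp [EuclideanSpace.inner_eq_star_dotProduct, Matrix.dotProduct_mulVec]

/-- The law of a linear form of the centred vector depends only on the value of the quadratic form
of the scale matrix. -/
theorem IsElliptical.map_dotProduct_eq [IsProbabilityMeasure P]
    (hell : IsElliptical Z P m S φ) (hZ : Measurable Z) {s t : ι → ℝ}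
    (hst : quadForm S s = quadForm S t) :
    P.map (fun ω => s ⬝ᵥ (Z ω - m).ofLp) = P.map fun ω => t ⬝ᵥ (Z ω - m).ofLp := by
  have h1 : IsProbabilityMeasure (P.map fun ω => s ⬝ᵥ (Z ω - m).ofLp) :=
    Measure.isProbabilityMeasure_map (measurable_dotProduct hZ m s).aemeasurable
  have h2 : IsProbabilityMeasure (P.map fun ω => t ⬝ᵥ (Z ω - m).ofLp) :=
    Measure.isProbabilityMeasure_map (measurable_dotProduct hZ m t).aemeasurable
  refine Measure.ext_of_charFun (funext fun u => ?_)
  rw [hell.charFun_dotProduct hZ, hell.charFun_dotProduct hZ, hst]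

variable [DecidableEq ι]

theorem ae_coord_eq_of_dotProduct {i : ι}
    (h : ∀ᵐ ω ∂P, (Pi.single i 1 : ι → ℝ) ⬝ᵥ (Z ω - m).ofLp = 0) : ∀ᵐ ω ∂P, Z ω i = m i := by
  filter_upwards [h] with ω hω
  simpa [sub_eq_zero] using hω

theorem IsElliptical.quadForm_single_pos [IsProbabilityMeasure P]
    (hell : IsElliptical Z P m S φ) (hZ : Measurable Z) {i : ι}
    (hnd : NonDegenerate (fun ω => Z ω i) P) : 0 < quadForm S (Pi.single i 1) := by
  refine lt_of_le_of_ne (quadForm_nonneg hell.1 _) fun h => hnd ⟨m i, ?_⟩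
  exact ae_coord_eq_of_dotProduct (hell.dotProduct_ae_eq_zero_of_quadForm hZ h.symm)

theorem IsElliptical.exists_ne_one [IsProbabilityMeasure P]
    (hell : IsElliptical Z P m S φ) (hZ : Measurable Z) {i : ι}
    (hnd : NonDegenerate (fun ω => Z ω i) P) : ∃ r, φ r ≠ 1 := by
  by_contra! h
  refine hnd ⟨m i, ae_coord_eq_of_dotProduct ?_⟩
  rw [hell.dotProduct_ae_eq_zero_iff hZ]
  exact fun u => h _

/-- An elliptical vector with exponential generator is Gaussian. -/
theorem IsElliptical.hasGaussianLaw_of_exp [IsProbabilityMeasure P]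
    (hell : IsElliptical Z P m S φ) (hZ : Measurable Z) {k : ℝ} (hk : 0 ≤ k)
    (hφ : ∀ x : ℝ≥0, φ x = Real.exp (-(k * x))) : HasGaussianLaw Z P := by
  have hprob : IsProbabilityMeasure (P.map Z) := Measure.isProbabilityMeasure_map hZ.aemeasurable
  have hS : ((2 * k) • S).PosSemidef := hell.1.smul (by positivity)
  have hZm : P.map Z = (P.map fun ω => Z ω - m).map (· + m) := by
    rw [Measure.map_map (measurable_add_const m) (hZ.sub_const m)]
    congr 1
    funext ω
    simp
  -- The factor two cancels the one half in the Gaussian characteristic function.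
  have h : P.map Z = multivariateGaussian m ((2 * k) • S) := by
    refine Measure.ext_of_charFun (funext fun t => ?_)
    rw [charFun_multivariateGaussian hS, hZm, charFun_map_add_const, hell.2, hφ,
      Real.coe_toNNReal (t.ofLp ⬝ᵥ S *ᵥ t.ofLp) (quadForm_nonneg hell.1 t.ofLp),
      Complex.ofReal_exp, ← Complex.exp_add, real_inner_comm]
    congr 1
    rw [Matrix.smul_mulVec, dotProduct_smul, smul_eq_mul]
    push_cast
    ring
  refine ⟨?_⟩
  rw [h]
  infer_instance

end Elliptical

/-! ### The two blocks of the elliptical vector. -/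

section Joint

theorem single_dotProduct_joint_inl {Ω : Type*} {p q : ℕ} {X : Ω → EuclideanSpace ℝ (Fin p)}
    {Y : Ω → EuclideanSpace ℝ (Fin q)} {m : EuclideanSpace ℝ (Fin p ⊕ Fin q)} (i : Fin p) (ω : Ω) :
    (Pi.single (Sum.inl i) 1 : Fin p ⊕ Fin q → ℝ) ⬝ᵥ (joint X Y ω - m).ofLp =
      X ω i - m (Sum.inl i) := by
  simp [joint]

theorem single_dotProduct_joint_inr {Ω : Type*} {p q : ℕ} {X : Ω → EuclideanSpace ℝ (Fin p)}
    {Y : Ω → EuclideanSpace ℝ (Fin q)} {m : EuclideanSpace ℝ (Fin p ⊕ Fin q)} (j : Fin q) (ω : Ω) :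
    (Pi.single (Sum.inr j) 1 : Fin p ⊕ Fin q → ℝ) ⬝ᵥ (joint X Y ω - m).ofLp =
      Y ω j - m (Sum.inr j) := by
  simp [joint]

/-- The coefficient vector `(-Aᵀ w, w)` tests the residual of the affine regression with slope `A`
in direction `w`; both directions of (ii) rest on it. -/
theorem sumElim_neg_dotProduct_joint {Ω : Type*} {p q : ℕ} {X : Ω → EuclideanSpace ℝ (Fin p)}
    {Y : Ω → EuclideanSpace ℝ (Fin q)} {m : EuclideanSpace ℝ (Fin p ⊕ Fin q)}
    (A : Matrix (Fin q) (Fin p) ℝ) (w : Fin q → ℝ) (ω : Ω) :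
    Sum.elim (-(Aᵀ *ᵥ w)) w ⬝ᵥ (joint X Y ω - m).ofLp =
      w ⬝ᵥ ((fun j => Y ω j - m (Sum.inr j)) - A *ᵥ fun i => X ω i - m (Sum.inl i)) := by
  have hsplit : (joint X Y ω - m).ofLp =
      Sum.elim (fun i => X ω i - m (Sum.inl i)) fun j => Y ω j - m (Sum.inr j) := by
    funext k
    cases k <;> simp [joint]
  rw [hsplit, sumElim_dotProduct_sumElim, neg_dotProduct, dotProduct_sub,
    Matrix.dotProduct_mulVec, Matrix.mulVec_transpose]
  ring

theorem quadForm_smul_single_add {ι : Type*} [Fintype ι] [DecidableEq ι] {S : Matrix ι ι ℝ}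
    (hS : S.PosSemidef) (i j : ι) (s t : ℝ) :
    quadForm S (s • Pi.single i 1 + t • Pi.single j 1) =
      s ^ 2 * quadForm S (Pi.single i 1) + 2 * (s * t) * S i j +
        t ^ 2 * quadForm S (Pi.single j 1) := by
  have hsymm : S j i = S i j := by simpa using hS.isHermitian.apply i j
  simp only [quadForm, Matrix.mulVec_add, Matrix.mulVec_smul, dotProduct_add, add_dotProduct,
    dotProduct_smul, smul_dotProduct, smul_eq_mul, Matrix.mulVec_single_one, single_dotProduct,
    one_mul, Matrix.col_apply, hsymm]
  ring

variable {Ω : Type*} [MeasurableSpace Ω] {P : Measure Ω} [IsProbabilityMeasure P] {p q : ℕ}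
  {X : Ω → EuclideanSpace ℝ (Fin p)} {Y : Ω → EuclideanSpace ℝ (Fin q)}
  {m : EuclideanSpace ℝ (Fin p ⊕ Fin q)} {S : Matrix (Fin p ⊕ Fin q) (Fin p ⊕ Fin q) ℝ}
  {φ : ℝ≥0 → ℝ}

theorem measurable_joint (hX : Measurable X) (hY : Measurable Y) : Measurable (joint X Y) := by
  refine (WithLp.measurable_toLp 2 _).comp (measurable_pi_lambda _ fun k => ?_)
  cases k with
  | inl i => exact measurable_coord i hX
  | inr j => exact measurable_coord j hY

/-- If the two parts of an elliptical vector are independent, then the vector is Gaussian and the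
off-diagonal block of the scale matrix vanishes. -/
theorem gaussian_of_indepFun (hp : 1 ≤ p) (hq : 1 ≤ q) (hX : Measurable X) (hY : Measurable Y)
    (hell : IsElliptical (joint X Y) P m S φ) (hXnd : ∀ i, NonDegenerate (fun ω => X ω i) P)
    (hYnd : ∀ j, NonDegenerate (fun ω => Y ω j) P) (hind : IndepFun X Y P) :
    S.toBlocks₁₂ = 0 ∧ HasGaussianLaw (joint X Y) P := by
  have hZ := measurable_joint hX hY
  have ha : ∀ i : Fin p, 0 < quadForm S (Pi.single (Sum.inl i) 1) := fun i =>
    hell.quadForm_single_pos hZ (hXnd i)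
  have hb : ∀ j : Fin q, 0 < quadForm S (Pi.single (Sum.inr j) 1) := fun j =>
    hell.quadForm_single_pos hZ (hYnd j)
  have hc : Continuous φ := hell.continuous hZ (ha ⟨0, hp⟩)
  have h0 : φ 0 = 1 := hell.apply_zero hZ
  have hmul : ∀ (i : Fin p) (j : Fin q) (s t : ℝ),
      φ (s ^ 2 * quadForm S (Pi.single (Sum.inl i) 1) + 2 * (s * t) * S (Sum.inl i) (Sum.inr j) +
        t ^ 2 * quadForm S (Pi.single (Sum.inr j) 1)).toNNReal =
      φ (s ^ 2 * quadForm S (Pi.single (Sum.inl i) 1)).toNNReal *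
        φ (t ^ 2 * quadForm S (Pi.single (Sum.inr j) 1)).toNNReal := by
    intro i j s t
    rw [← quadForm_smul_single_add hell.1, ← quadForm_smul, ← quadForm_smul]
    refine hell.map_mul_of_indepFun hZ ?_
    simp only [smul_dotProduct, single_dotProduct_joint_inl, single_dotProduct_joint_inr]
    exact hind.comp (φ := fun x => s • (x i - m (Sum.inl i)))
      (ψ := fun y => t • (y j - m (Sum.inr j)))
      (((measurable_coord i measurable_id).sub_const _).const_smul s)
      (((measurable_coord j measurable_id).sub_const _).const_smul t)
  have hzero : ∀ i j, S (Sum.inl i) (Sum.inr j) = 0 := fun i j =>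
    mixed_coeff_eq_zero hc h0 (hell.exists_ne_one hZ (i := Sum.inr j) (hYnd j)) (ha i) (hb j) (hmul i j)
  refine ⟨by ext i j; exact hzero i j, ?_⟩
  -- With the mixed term gone, one coordinate from each block suffices; the square roots turn the
  -- two arguments into arbitrary `x` and `y`.
  obtain ⟨k, hk, hexp⟩ := exists_eq_exp_of_map_add hc h0 (hell.le_one hZ (ha ⟨0, hp⟩)) fun x y => by
    have h := hmul ⟨0, hp⟩ ⟨0, hq⟩ (√(x / quadForm S (Pi.single (Sum.inl ⟨0, hp⟩) 1)))
      (√(y / quadForm S (Pi.single (Sum.inr ⟨0, hq⟩) 1)))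
    have hx := (ha ⟨0, hp⟩).le
    have hy := (hb ⟨0, hq⟩).le
    rwa [hzero, mul_zero, add_zero, Real.sq_sqrt (by positivity), Real.sq_sqrt (by positivity),
      div_mul_cancel₀ _ (ha ⟨0, hp⟩).ne', div_mul_cancel₀ _ (hb ⟨0, hq⟩).ne', Real.toNNReal_coe,
      Real.toNNReal_coe, Real.toNNReal_add x.coe_nonneg y.coe_nonneg, Real.toNNReal_coe,
      Real.toNNReal_coe] at h
  exact hell.hasGaussianLaw_of_exp hZ hk hexp

/-- If an elliptical vector is Gaussian and the off-diagonal block of its scale matrix vanishes,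
then its two parts are independent. -/
theorem indepFun_of_gaussian (hX : Measurable X) (hY : Measurable Y)
    (hell : IsElliptical (joint X Y) P m S φ) (hS : S.toBlocks₁₂ = 0)
    (hG : HasGaussianLaw (joint X Y) P) : IndepFun X Y P := by
  have hZ := measurable_joint hX hY
  have hpair : HasGaussianLaw (fun ω => ((fun i => X ω i), fun j => Y ω j)) P :=
    hG.map_fun ((ContinuousLinearMap.pi fun i : Fin p =>
      EuclideanSpace.proj (𝕜 := ℝ) (Sum.inl i : Fin p ⊕ Fin q)).prod
      (ContinuousLinearMap.pi fun j : Fin q =>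
        EuclideanSpace.proj (𝕜 := ℝ) (Sum.inr j : Fin p ⊕ Fin q)))
  have hcov : ∀ (i : Fin p) (j : Fin q), cov[fun ω => X ω i, fun ω => Y ω j; P] = 0 := by
    intro i j
    have hXL : MemLp (fun ω => X ω i) 2 P :=
      (HasGaussianLaw.eval (X := fun i ω => X ω i) hpair.fst i).memLp_two
    have hYL : MemLp (fun ω => Y ω j) 2 P :=
      (HasGaussianLaw.eval (X := fun j ω => Y ω j) hpair.snd j).memLp_two
    have hXi : MemLp (fun ω => X ω i - m (Sum.inl i)) 2 P := hXL.sub (memLp_const _)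
    have hYj : MemLp (fun ω => Y ω j - m (Sum.inr j)) 2 P := hYL.sub (memLp_const _)
    have hq1 := quadForm_smul_single_add hell.1 (Sum.inl i) (Sum.inr j) 1 1
    have hq2 := quadForm_smul_single_add hell.1 (Sum.inl i) (Sum.inr j) 1 (-1)
    have hzero : S (Sum.inl i) (Sum.inr j) = 0 := congrFun (congrFun hS i) j
    -- The centred sum and difference of the two coordinates have the same law, hence equal
    -- variances, which differ by four times the covariance. This avoids relating `S` to the
    -- covariance matrix.
    have hlaw := hell.map_dotProduct_eq hZ (hq1.trans (Eq.trans (by rw [hzero]; ring) hq2.symm))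
    have hvar := (⟨(measurable_dotProduct hZ m _).aemeasurable,
      (measurable_dotProduct hZ m _).aemeasurable, hlaw⟩ : IdentDistrib _ _ P P).variance_eq
    simp only [add_dotProduct, single_dotProduct_joint_inl,
      single_dotProduct_joint_inr, one_smul, neg_smul, ← sub_eq_add_neg,
      sub_dotProduct] at hvar
    have h1 := variance_add hXi hYj
    have h2 := variance_sub hXi hYj
    have h3 : cov[fun ω => X ω i - m (Sum.inl i), fun ω => Y ω j - m (Sum.inr j); P] = 0 := by
      have h4 : Var[(fun ω => X ω i - m (Sum.inl i)) + fun ω => Y ω j - m (Sum.inr j); P] =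
        Var[(fun ω => X ω i - m (Sum.inl i)) - fun ω => Y ω j - m (Sum.inr j); P] := hvar
      linarith
    rwa [covariance_sub_const_left (hXL.integrable one_le_two),
      covariance_sub_const_right (hYL.integrable one_le_two)] at h3
  have h := HasGaussianLaw.indepFun_of_covariance_eval (X := fun i ω => X ω i)
    (Y := fun j ω => Y ω j) hpair hcov
  exact h.comp (WithLp.measurable_toLp 2 _) (WithLp.measurable_toLp 2 _)

theorem mulVec_sumElim_neg (A : Matrix (Fin q) (Fin p) ℝ) (w : Fin q → ℝ) :
    S *ᵥ Sum.elim (-(Aᵀ *ᵥ w)) w = Sum.elim (S.toBlocks₁₂ *ᵥ w - (S.toBlocks₁₁ * Aᵀ) *ᵥ w)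
      (S.toBlocks₂₂ *ᵥ w - (S.toBlocks₂₁ * Aᵀ) *ᵥ w) := by
  conv_lhs => rw [← Matrix.fromBlocks_toBlocks S]
  simp only [Matrix.fromBlocks_mulVec, Sum.elim_comp_inl, Sum.elim_comp_inr, Matrix.mulVec_neg,
    Matrix.mulVec_mulVec]
  congr 1 <;> abel

/-- If the lower rows of the scale matrix are a left multiple of the upper rows, then the second
part of an elliptical vector is almost surely an affine function of the first part. -/
theorem exists_measurable_of_eq_mul (hX : Measurable X) (hY : Measurable Y)
    (hell : IsElliptical (joint X Y) P m S φ) {A : Matrix (Fin q) (Fin p) ℝ}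
    (h21 : S.toBlocks₂₁ = A * S.toBlocks₁₁) (h22 : S.toBlocks₂₂ = A * S.toBlocks₁₂) :
    ∃ f : EuclideanSpace ℝ (Fin p) → EuclideanSpace ℝ (Fin q), Measurable f ∧ Y =ᵐ[P] f ∘ X := by
  have hZ := measurable_joint hX hY
  have hsymm : S.toBlocks₁₁ᵀ = S.toBlocks₁₁ := by
    ext i j
    exact hell.1.isHermitian.apply (Sum.inl i) (Sum.inl j)
  have h12 : S.toBlocks₁₂ = S.toBlocks₁₁ * Aᵀ := by
    rw [toBlocks₁₂_eq_transpose hell.1, h21, Matrix.transpose_mul, hsymm]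
  have hzero : ∀ w : Fin q → ℝ, quadForm S (Sum.elim (-(Aᵀ *ᵥ w)) w) = 0 := by
    intro w
    rw [quadForm_eq_zero_iff hell.1, mulVec_sumElim_neg, ← h12, h22, h21, Matrix.mul_assoc, ← h12,
      sub_self, sub_self]
    funext k
    cases k <;> rfl
  refine ⟨fun x => WithLp.toLp 2 fun j =>
    m (Sum.inr j) + (A *ᵥ fun i => x i - m (Sum.inl i)) j, ?_, ?_⟩
  · refine (WithLp.measurable_toLp 2 _).comp (measurable_pi_lambda _ fun j =>
      Measurable.const_add ?_ _)
    change Measurable fun x : EuclideanSpace ℝ (Fin p) => ∑ i, A j i * (x i - m (Sum.inl i))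
    exact Finset.measurable_sum _ fun i _ =>
      ((measurable_coord i measurable_id).sub_const _).const_mul _
  · have hae := ae_all_iff.2 fun j : Fin q =>
      hell.dotProduct_ae_eq_zero_of_quadForm hZ (hzero (Pi.single j 1))
    filter_upwards [hae] with ω hω
    ext j
    have := hω j
    rw [sumElim_neg_dotProduct_joint, single_dotProduct, one_mul, Pi.sub_apply] at this
    change Y ω j = m (Sum.inr j) + (A *ᵥ fun i => X ω i - m (Sum.inl i)) j
    linarith

/-- If the second part of an elliptical vector is almost surely a function of the first part, then
the lower rows of the scale matrix are a left multiple of the upper rows. -/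
theorem exists_eq_mul_of_ae_eq (hX : Measurable X) (hY : Measurable Y)
    (hell : IsElliptical (joint X Y) P m S φ) (hne : ∃ r, φ r ≠ 1)
    {f : EuclideanSpace ℝ (Fin p) → EuclideanSpace ℝ (Fin q)} (hf : Measurable f)
    (hYf : Y =ᵐ[P] f ∘ X) :
    ∃ A : Matrix (Fin q) (Fin p) ℝ, S.toBlocks₂₁ = A * S.toBlocks₁₁ ∧
      S.toBlocks₂₂ = A * S.toBlocks₁₂ := by
  have hZ := measurable_joint hX hY
  obtain ⟨A, h21⟩ := exists_toBlocks₂₁_eq_mul hell.1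
  refine ⟨A, h21, ?_⟩
  have hsymm : S.toBlocks₁₁ᵀ = S.toBlocks₁₁ := by
    ext i j
    exact hell.1.isHermitian.apply (Sum.inl i) (Sum.inl j)
  have h12 : S.toBlocks₁₂ = S.toBlocks₁₁ * Aᵀ := by
    rw [toBlocks₁₂_eq_transpose hell.1, h21, Matrix.transpose_mul, hsymm]
  -- Reflection through the graph of `A` along the second block: it fixes `x` and changes the sign
  -- of the residual `y - A x`.
  set M : Matrix (Fin p ⊕ Fin q) (Fin p ⊕ Fin q) ℝ :=
    Matrix.fromBlocks 1 0 ((2 : ℝ) • A) (-1) with hMdef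
  have hM : M * S * Mᵀ = S := by
    conv_lhs => rw [← Matrix.fromBlocks_toBlocks S]
    conv_rhs => rw [← Matrix.fromBlocks_toBlocks S]
    rw [hMdef, Matrix.fromBlocks_transpose, Matrix.fromBlocks_multiply, Matrix.fromBlocks_multiply]
    simp only [Matrix.transpose_one, Matrix.transpose_zero, Matrix.transpose_neg,
      Matrix.transpose_smul, Matrix.one_mul, Matrix.zero_mul, Matrix.mul_one, Matrix.mul_zero,
      add_zero, Matrix.smul_mul, Matrix.mul_smul, Matrix.neg_mul, Matrix.mul_neg, ← h12, ← h21]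
    have hAS : S.toBlocks₂₁ * Aᵀ = A * S.toBlocks₁₂ := by rw [h21, h12, Matrix.mul_assoc]
    have htwo : (2 : ℝ) • S.toBlocks₂₁ + -S.toBlocks₂₁ = S.toBlocks₂₁ := by
      rw [two_smul]
      abel
    rw [htwo, hAS]
    congr 1
    · rw [two_smul]
      abel
    · abel
  let g : EuclideanSpace ℝ (Fin p ⊕ Fin q) → EuclideanSpace ℝ (Fin p) := fun z =>
    WithLp.toLp 2 fun i => z (Sum.inl i) + m (Sum.inl i)
  have hg : Measurable g := (WithLp.measurable_toLp 2 _).comp (measurable_pi_lambda _ fun i =>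
    (measurable_coord (Sum.inl i) measurable_id).add_const _)
  -- The relation `Y = f(X)` as a measurable event of the centred vector, so that it transfers to
  -- the reflected vector by equality of laws.
  let D : Set (EuclideanSpace ℝ (Fin p ⊕ Fin q)) :=
    {z | ∀ j : Fin q, z (Sum.inr j) + m (Sum.inr j) = f (g z) j}
  have hD : MeasurableSet D := by
    have : D = ⋂ j : Fin q, {z | z (Sum.inr j) + m (Sum.inr j) = f (g z) j} := by
      ext z
      simp [D]
    rw [this]
    exact MeasurableSet.iInter fun j => measurableSet_eq_fun
      ((measurable_coord (Sum.inr j) measurable_id).add_const _)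
      (measurable_coord j (hf.comp hg))
  have hgX : ∀ ω, g (joint X Y ω - m) = X ω := fun ω => by
    ext i
    simp [g, joint]
  have hMZ : ∀ ω, M *ᵥ (joint X Y ω - m).ofLp = Sum.elim (fun i => X ω i - m (Sum.inl i))
      ((2 : ℝ) • (A *ᵥ fun i => X ω i - m (Sum.inl i)) - fun j => Y ω j - m (Sum.inr j)) := by
    intro ω
    have hsplit : (joint X Y ω - m).ofLp =
        Sum.elim (fun i => X ω i - m (Sum.inl i)) fun j => Y ω j - m (Sum.inr j) := by
      funext k
      cases k <;> simp [joint]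
    rw [hsplit, hMdef, Matrix.fromBlocks_mulVec]
    simp [Matrix.smul_mulVec, Matrix.neg_mulVec, sub_eq_add_neg]
  have hgM : ∀ ω, g (WithLp.toLp 2 (M *ᵥ (joint X Y ω - m).ofLp)) = X ω := fun ω => by
    ext i
    change (M *ᵥ (joint X Y ω - m).ofLp) (Sum.inl i) + m (Sum.inl i) = X ω i
    rw [hMZ]
    simp
  have h1 : ∀ᵐ z ∂(P.map fun ω => joint X Y ω - m), z ∈ D := by
    rw [ae_map_iff (p := (· ∈ D)) (hZ.sub_const m).aemeasurable hD]
    filter_upwards [hYf] with ω hω j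
    rw [hgX]
    have hj : (joint X Y ω - m) (Sum.inr j) + m (Sum.inr j) = Y ω j := by simp [joint]
    rw [hj, hω]
    rfl
  have hMm : Measurable fun ω =>
      (WithLp.toLp 2 (M *ᵥ (joint X Y ω - m).ofLp) : EuclideanSpace ℝ (Fin p ⊕ Fin q)) :=
    (WithLp.measurable_toLp 2 _).comp (measurable_pi_lambda _ fun i =>
      measurable_dotProduct hZ m (M i))
  rw [← hell.map_mulVec hZ hM, ae_map_iff (p := (· ∈ D)) hMm.aemeasurable hD] at h1
  have hlin : ∀ᵐ ω ∂P, (fun j => Y ω j - m (Sum.inr j)) - A *ᵥ (fun i => X ω i - m (Sum.inl i)) =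
      0 := by
    filter_upwards [hYf, h1] with ω hω h2
    funext j
    have h3 := h2 j
    rw [hgM, ← Function.comp_apply (f := f), ← hω] at h3
    have h4 : (2 : ℝ) * (A *ᵥ fun i => X ω i - m (Sum.inl i)) j - (Y ω j - m (Sum.inr j)) +
        m (Sum.inr j) = Y ω j := by
      rw [hMZ] at h3
      exact h3
    simp only [Pi.sub_apply, Pi.zero_apply]
    linarith
  -- The residual vanishes almost surely, so its coefficient vector lies in the kernel of `S`; the
  -- lower half of that equation is the claim.
  have hw : ∀ w : Fin q → ℝ, S.toBlocks₂₂ *ᵥ w = (A * S.toBlocks₁₂) *ᵥ w := by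
    intro w
    have hquad : quadForm S (Sum.elim (-(Aᵀ *ᵥ w)) w) = 0 := by
      refine hell.quadForm_eq_zero_of_ae hZ hne ?_
      filter_upwards [hlin] with ω hω
      rw [sumElim_neg_dotProduct_joint, hω, dotProduct_zero]
    rw [quadForm_eq_zero_iff hell.1, mulVec_sumElim_neg] at hquad
    have hr : S.toBlocks₂₂ *ᵥ w - (S.toBlocks₂₁ * Aᵀ) *ᵥ w = 0 := by
      funext j
      exact congrFun hquad (Sum.inr j)
    rw [sub_eq_zero.1 hr, h21, h12, Matrix.mul_assoc]
  exact Matrix.ext_of_mulVec_single fun j => hw _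

end Joint

end RankDep

theorem mainTheorem7 {Ω : Type*} [MeasurableSpace Ω] (P : Measure Ω) [IsProbabilityMeasure P]
    {p q : ℕ} (hp : 1 ≤ p) (hq : 1 ≤ q)
    (X : Ω → EuclideanSpace ℝ (Fin p)) (Y : Ω → EuclideanSpace ℝ (Fin q))
    (hX : Measurable X) (hY : Measurable Y)
    (m : EuclideanSpace ℝ (Fin p ⊕ Fin q)) (S : Matrix (Fin p ⊕ Fin q) (Fin p ⊕ Fin q) ℝ)
    (φ : ℝ≥0 → ℝ)
    (hell : RankDep.IsElliptical (RankDep.joint X Y) P m S φ)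
    (hXnd : ∀ i : Fin p, RankDep.NonDegenerate (fun ω => X ω i) P)
    (hYnd : ∀ j : Fin q, RankDep.NonDegenerate (fun ω => Y ω j) P) :
    (RankDep.T Y X P = 0 ↔ S.toBlocks₁₂ = 0 ∧ HasGaussianLaw (RankDep.joint X Y) P) ∧
    (RankDep.T Y X P = 1 ↔ S.rank = S.toBlocks₁₁.rank) := by
  refine ⟨(RankDep.T_eq_zero_iff_indepFun hq hX hY hYnd).trans
    ⟨RankDep.gaussian_of_indepFun hp hq hX hY hell hXnd hYnd,
      fun h => RankDep.indepFun_of_gaussian hX hY hell h.1 h.2⟩, ?_⟩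
  rw [RankDep.T_eq_one_iff_exists_measurable hq hX hY hYnd,
    RankDep.rank_eq_rank_toBlocks₁₁_iff hell.1]
  constructor
  · rintro ⟨f, hf, hYf⟩
    exact RankDep.exists_eq_mul_of_ae_eq hX hY hell
      (hell.exists_ne_one (RankDep.measurable_joint hX hY) (i := Sum.inr ⟨0, hq⟩)
        (hYnd ⟨0, hq⟩)) hf hYf
  · rintro ⟨A, h21, h22⟩
    exact RankDep.exists_measurable_of_eq_mul hX hY hell h21 h22
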